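/- **Setting.** Let $\Omega\subset\mathbb R^p$ be open and let $X_0,X_1,\dots,X_n$ be $C^\infty$ vector fields on $\Omega$. Give $X_0$ the weight $p_0=2$ and $X_i$ the weight $p_i=1$ for $1\le i\le n$. For a multiindex $I=(i_1,\dots,i_k)$, $k\ge 1$, $i_j\in\{0,\dots,n\}$, put $|I|=\sum_j p_{i_j}$ and $X_{[I]}=[X_{i_1},[X_{i_2},\dots[X_{i_{k-1}},X_{i_k}]\dots]]$. Let $A_{IJ}$ be the universal constants with $\xi_{[I]}=\sum_J A_{IJ}\,\xi_{j_1}\cdots\xi_{j_m}$ (sum over $J=(j_1,\dots,j_m)$) in the algebra of polynomials in noncommuting variables $\xi_0,\dots,\xi_n$, where $\xi_{[I]}$ is the corresponding nested commutator. Let $r\in\mathbb N$ and assume that $X_0,\dots,X_n$ are free up to weight $r$ at every $x\in\Omega$: if $\sum_{|I|\le r}a_I(X_{[I]})_x=0$ with $a_I\in\mathbb R$, then $\sum_{|I|\le r}a_IA_{IJ}=0$ for all $J$. Let $B$ be a set of multiindices of weight $\le r$ such that $\{(X_{[I]})_x\}_{I\in B}$ is a basis of $\mathbb R^p$ for every $x\in\Omega$.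 For a vector field $Z$ on $\Omega$ write $\xi=\exp(Z)(\eta)$ if $\xi=\varphi(1)$ for a solution $\varphi:[0,1]\to\Omega$ of $\varphi'=Z_\varphi$, $\varphi(0)=\eta$. The canonical coordinates $u=(u_I)_{I\in B}$ centred at $\eta\in\Omega$ are those given near $u=0$ by $u\mapsto\exp\big(\sum_{I\in B}u_IX_{[I]}\big)(\eta)$. A *map* $\Theta$ on an open set $W\subset\Omega\times\Omega$ is a $C^\infty$ map $\Theta:W\to\mathbb R^B$ such that $\Theta(\eta,\eta)=0$ whenever $(\eta,\eta)\in W$, and, for all $(\eta,\xi)\in W$, $\xi=\exp\big(\sum_{I\in B}u_IX_{[I]}\big)(\eta)$ with $u=\Theta(\eta,\xi)$, and $\Theta(\eta,\cdot)$ is a local diffeomorphism at $\xi$. Write $e_I=\partial/\partial u_I$. A function $f$, smooth near $u=0$, has weight $\ge s$ ($s\in\mathbb Z$) if its Taylor expansion at $0$ contains no term $a\,u_{I_1}\cdots u_{I_k}$ with $a\ne0$, $|I_1|+\dots+|I_k|<s$; a vector field $\sum_{I\in B}f_Ie_I$ has weight $\ge s$ at $u=0$ if each $f_I$ has weight $\ge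 s+|I|$. A vector field on $\Omega$ has weight $\ge s$ at $\eta$ if its expression in the canonical coordinates centred at $\eta$ has weight $\ge s$ at $u=0$. Let $X^{u}_{[I]}$ be the expression of $X_{[I]}$ in the coordinates centred at $\eta$. **Theorem (approximation, local version).** 1. For every $\xi_0\in\Omega$ there are an open $W\ni(\xi_0,\xi_0)$ and a map $\Theta$ on $W$ as above. 2. For every multiindex $I$, $X_{[I]}$ has weight $\ge-|I|$ at every point of $\Omega$. 3. Let $Y_0,\dots,Y_n$ be $C^\infty$ vector fields on an open neighbourhood $V$ of $0$ in $\mathbb R^B$ satisfying $$\sum_{I\in B}u_Ie_I=\sum_{I\in B}u_IY_{[I]}\quad\text{on }V.$$ Then for every $\eta\in\Omega$ and every multiindex $I$, the vector field $X^{u}_{[I]}-Y_{[I]}$ has weight $\ge1-|I|$ at $u=0$. 4. Moreover, for $Y$ as in 3, there are vector fields $R_{\eta,[I]}$ ($\eta\in\Omega$, $I$ a multiindex) in the variables $u$, of weight $\ge1-|I|$ at $u=0$, such that for every map $\Theta$ as above on an open $W\subset\Omega\times\Omega$ and every $I$: the map $(\eta,u)\mapsto R_{\eta,[I]}(u)$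 is $C^\infty$ on $\{(\eta,\Theta(\eta,\xi)):(\eta,\xi)\in W,\ \Theta(\eta,\xi)\in V\}$, and, for all $(\eta,\xi)\in W$ with $\Theta(\eta,\xi)\in V$ and every real function $f$ smooth at $\Theta(\eta,\xi)$, $$X_{[I]}^{\xi}\big[f(\Theta(\eta,\xi))\big]=\big(Y_{[I]}f\big)(\Theta(\eta,\xi))+\big(R_{\eta,[I]}f\big)(\Theta(\eta,\xi)),$$ where $X_{[I]}^{\xi}$ acts on the variable $\xi$. -/

import Mathlib

open Set Filter Topology
open scoped ContDiff

namespace HormanderApprox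

noncomputable section

/-! ### Multiindices, weights and nested commutators -/

/-- A multiindex `(i₁, …, i_k)` with entries in `{0, 1, …, n}`. -/
abbrev MultiIndex (n : ℕ) : Type := List (Fin (n + 1))

/-- The weights of the generators: `p₀ = 2` and `pᵢ = 1` for `i = 1, …, n`. -/
def genWeight {n : ℕ} (i : Fin (n + 1)) : ℕ := if i = 0 then 2 else 1

/-- The weight `|I| = p_{i₁} + ⋯ + p_{i_k}` of a multiindex. -/
def weight {n : ℕ} (I : MultiIndex n) : ℕ := (I.map genWeight).sum

/-- The nested bracket `[x_{i₁}, [x_{i₂}, … [x_{i_{k-1}}, x_{i_k}] … ]]` for a given bracket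
operation `br` (the value at the empty list, which is not a multiindex, is `0`). -/
def nested {ι L : Type*} [Zero L] (br : L → L → L) (x : ι → L) : List ι → L
  | [] => 0
  | [i] => x i
  | i :: j :: I => br (x i) (nested br x (j :: I))

/-- The vector field `X_[I]`, with the Lie bracket of vector fields. -/
def comm {n : ℕ} {E : Type*} [NormedAddCommGroup E] [NormedSpace ℝ E]
    (X : Fin (n + 1) → E → E) (I : MultiIndex n) : E → E :=
  nested (VectorField.lieBracket ℝ) X I

/-- The algebra of polynomials in the noncommuting variables `ξ₀, …, ξ_n`. -/
abbrev NCPoly (n : ℕ) : Type := MonoidAlgebra ℝ (FreeMonoid (Fin (n + 1)))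

/-- The formal commutator `ξ_[I]`, with `[a, b] = a b - b a`. -/
def formalComm {n : ℕ} (I : MultiIndex n) : NCPoly n :=
  nested (fun a b => a * b - b * a) (fun i => MonoidAlgebra.of ℝ _ (FreeMonoid.of i)) I

/-- The universal constants `A_{IJ}` with `ξ_[I] = ∑_J A_{IJ} ξ_J`, and hence
`X_[I] = ∑_J A_{IJ} X_J` for all systems of vector fields. -/
def univConst {n : ℕ} (I J : MultiIndex n) : ℝ :=
  (formalComm I).coeff (FreeMonoid.ofList J)

/-- `X₀, …, X_n` are free up to weight `s` at the point `x`: every family of constants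
`(a_I)_{|I| ≤ s}` with `∑ a_I (X_[I])_x = 0` satisfies `∑ a_I A_{IJ} = 0` for all `J`. -/
def FreeUpTo {n : ℕ} {E : Type*} [NormedAddCommGroup E] [NormedSpace ℝ E]
    (X : Fin (n + 1) → E → E) (s : ℕ) (x : E) : Prop :=
  ∀ a : MultiIndex n →₀ ℝ, (∀ I ∈ a.support, I ≠ [] ∧ weight I ≤ s) →
    (a.sum fun I c => c • comm X I x) = 0 →
    ∀ J : MultiIndex n, (a.sum fun I c => c * univConst I J) = 0

/-! ### Exponential of a vector field, canonical coordinates -/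

/-- `y = exp(Z)(x)`: the solution in `Ω` of `φ' = Z(φ)`, `φ(0) = x` exists on `[0, 1]` and
`φ(1) = y`. -/
def IsExp {E : Type*} [NormedAddCommGroup E] [NormedSpace ℝ E]
    (Ω : Set E) (Z : E → E) (x y : E) : Prop :=
  ∃ φ : ℝ → E, φ 0 = x ∧ φ 1 = y ∧
    ∀ t ∈ Icc (0 : ℝ) 1, φ t ∈ Ω ∧ HasDerivWithinAt φ (Z (φ t)) (Icc 0 1) t

open Classical in
/-- The point `exp(Z)(x)`; by convention it is `x` when `exp(Z)(x)` does not exist. -/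
def expPoint {E : Type*} [NormedAddCommGroup E] [NormedSpace ℝ E]
    (Ω : Set E) (Z : E → E) (x : E) : E :=
  if h : ∃ y, IsExp Ω Z x y then h.choose else x

/-- The vector field `∑_{I ∈ B} u_I X_[I]` with constant coefficients `u = (u_I)_{I ∈ B}`. -/
def comboField {n : ℕ} {E : Type*} [NormedAddCommGroup E] [NormedSpace ℝ E]
    (X : Fin (n + 1) → E → E) (B : Finset (MultiIndex n)) (u : B → ℝ) : E → E :=
  fun x => ∑ I : B, u I • comm X I.1 x

/-- The canonical coordinates centred at `η`: the map `u ↦ exp(∑_{I ∈ B} u_I X_[I])(η)`. -/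
def canonicalMap {n : ℕ} {E : Type*} [NormedAddCommGroup E] [NormedSpace ℝ E]
    (Ω : Set E) (X : Fin (n + 1) → E → E) (B : Finset (MultiIndex n)) (η : E)
    (u : B → ℝ) : E :=
  expPoint Ω (comboField X B u) η

/-- The vector field `Z` expressed in the canonical coordinates `u` centred at `η`, i.e.
pulled back by the coordinate map: `u ↦ DE(u)⁻¹ Z(E(u))`, where `E = canonicalMap Ω X B η`. -/
def inCanonical {n : ℕ} {E : Type*} [NormedAddCommGroup E] [NormedSpace ℝ E]
    (Ω : Set E) (X : Fin (n + 1) → E → E) (B : Finset (MultiIndex n)) (η : E)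
    (Z : E → E) : (B → ℝ) → (B → ℝ) :=
  VectorField.pullback ℝ (canonicalMap Ω X B η) Z

/-- `Θ` is a map `u = Θ(η, ξ)`, defined on the open set `W ⊆ Ω × Ω`, giving the canonical
coordinates `u` centred at `η` of the point `ξ`: it is smooth, vanishes on the diagonal,
satisfies `ξ = exp(∑_{I ∈ B} u_I X_[I])(η)` for `u = Θ(η, ξ)`, and `ξ ↦ Θ(η, ξ)` is a local
diffeomorphism for every `η`. -/
structure IsThetaMap {n : ℕ} {E : Type*} [NormedAddCommGroup E] [NormedSpace ℝ E]
    (Ω : Set E) (X : Fin (n + 1) → E → E) (B : Finset (MultiIndex n))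
    (W : Set (E × E)) (Θ : E → E → (B → ℝ)) : Prop where
  isOpen : IsOpen W
  subset : W ⊆ Ω ×ˢ Ω
  smooth : ContDiffOn ℝ ∞ (fun q : E × E => Θ q.1 q.2) W
  diag : ∀ η, (η, η) ∈ W → Θ η η = 0
  exp_eq : ∀ η ξ, (η, ξ) ∈ W → IsExp Ω (comboField X B (Θ η ξ)) η ξ
  localDiffeo : ∀ η ξ, (η, ξ) ∈ W → (fderiv ℝ (Θ η) ξ).IsInvertible

/-! ### Weights of functions and vector fields in the coordinates `u` -/

/-- The smooth function `f` has weight `≥ s` at `u = 0`: the Taylor expansion of `f` at the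
origin has no nonzero term `a u_{I₁} ⋯ u_{I_k}` with `|I₁| + ⋯ + |I_k| < s`, that is,
`∂_{I₁} ⋯ ∂_{I_k} f(0) = 0` for such `I₁, …, I_k`. -/
def FunWeightGE {n : ℕ} {B : Finset (MultiIndex n)} (f : (B → ℝ) → ℝ) (s : ℤ) : Prop :=
  (∀ᶠ u in 𝓝 (0 : B → ℝ), ContDiffAt ℝ ∞ f u) ∧
  ∀ (k : ℕ) (K : Fin k → B), (∑ j, (weight (K j).1 : ℤ)) < s →
    iteratedFDeriv ℝ k f 0 (fun j => Pi.single (K j) (1 : ℝ)) = 0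

/-- The vector field `Z = ∑_{I ∈ B} f_I ∂/∂u_I` has weight `≥ s` at `u = 0`: every `f_I` has
weight `≥ s + |I|`. -/
def FieldWeightGE {n : ℕ} {B : Finset (MultiIndex n)} (Z : (B → ℝ) → (B → ℝ)) (s : ℤ) :
    Prop :=
  ∀ I : B, FunWeightGE (fun u => Z u I) (s + (weight I.1 : ℤ))

/-- The vector field `Z` as a differential operator: `(Z f)(x) = Df(x)(Z_x)`. -/
def act {E : Type*} [NormedAddCommGroup E] [NormedSpace ℝ E] (Z : E → E) (f : E → ℝ) (x : E) :
    ℝ :=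
  fderiv ℝ f x (Z x)

end

end HormanderApprox

namespace HormanderApprox

noncomputable section

/-! Freeness turns pointwise linear relations into formal ones. At a point the basis expresses each
`X_[L]` with `|L| ≤ r` through the `X_[K]`, `K ∈ B`. By freeness the same relation holds between the
formal commutators, and by homogeneity only the `K` with `|K| = |L|` are needed
(`exists_formalComm_eq_sum`). Brackets of commutators are again combinations of commutators
(`formalComm_comm_mem_commSpan`). Since noncommutative polynomials act as differential operators
(`ncRep`), every such formal identity, with the same constants, holds for the fields `X` and for any
other smooth system `Y`.

In canonical coordinates the rays through `0` are integral curves of the constant combinations, so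
the fields `W_J = X^u_[J]`, `J ∈ B`, satisfy `∑ u_I W_I = ∑ u_I e_I`; this is also the hypothesis on
`Y`. Both systems are therefore Euler frames with the same graded structure constants in weights `≤
r` (`EulerFrame`). Differentiating the Euler identity along `W_J` gives, for the matrix `D = W - 1`
and the Euler field `𝓔`, `(𝓔 + 1) D_J = -(D²)_J - ∑_I u_I [W_J, W_I]` (`EulerFrame.euler_defect`).
The operator `𝓔 + 1` multiplies Taylor terms of degree `d` by `d + 1`. Because `D` vanishes at `0`
and the bracket carries a factor `u_I`, the right side in each degree involves only lower-degree
terms of `D`. Induction on the degree gives the weight of `W_J` (`weight_defect`) and, after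
subtracting the equations of two frames, the gain of one unit of weight in their difference
(`weight_sub`). Brackets of weight above `r` have unknown coefficients but are already negligible by
weight.

The analytic part is smoothness of `(η, u) ↦ exp(∑ u_I X_[I])(η)`. It comes from the implicit
function theorem for the integral equation in the Banach space of continuous paths, whose
linearization is `1` minus a Volterra operator. The inverse function theorem then yields `Θ`, and
the remainder `R` is simply `X^u_[I] - Y_[I]`. -/

/-! ### Formal commutators in the free associative algebra. -/

theorem nested_cons {ι L : Type*} [Zero L] (br : L → L → L) (x : ι → L) (i : ι) {I : List ι}
    (hI : I ≠ []) : nested br x (i :: I) = br (x i) (nested br x I) := by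
  obtain ⟨j, I', rfl⟩ := List.exists_cons_of_ne_nil hI
  rfl

theorem weight_cons {n : ℕ} (i : Fin (n + 1)) (I : MultiIndex n) :
    weight (i :: I) = genWeight i + weight I := by
  simp [weight]

theorem weight_append {n : ℕ} (I J : MultiIndex n) : weight (I ++ J) = weight I + weight J := by
  simp [weight]

/-- The noncommuting variable `ξ_i`. -/
def ncVar {n : ℕ} (i : Fin (n + 1)) : NCPoly n := MonoidAlgebra.of ℝ _ (FreeMonoid.of i)

theorem formalComm_singleton {n : ℕ} (i : Fin (n + 1)) : formalComm [i] = ncVar i := rfl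

theorem formalComm_cons {n : ℕ} (i : Fin (n + 1)) {I : MultiIndex n} (hI : I ≠ []) :
    formalComm (i :: I) = ncVar i * formalComm I - formalComm I * ncVar i :=
  nested_cons _ _ i hI

/-- Induction over nonempty multiindices. -/
theorem multiIndex_induction {n : ℕ} {P : MultiIndex n → Prop} (h1 : ∀ i, P [i])
    (h2 : ∀ i I, I ≠ [] → P I → P (i :: I)) (I : MultiIndex n) (hI : I ≠ []) : P I := by
  induction I with
  | nil => exact absurd rfl hI
  | cons i I ih =>
    by_cases h : I = []
    · subst h; exact h1 i
    · exact h2 i I h (ih h)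

/-- The polynomials homogeneous of weight `w`. -/
def homog (n w : ℕ) : Submodule ℝ (NCPoly n) where
  carrier := {f | ∀ m : FreeMonoid (Fin (n + 1)), weight m.toList ≠ w → f.coeff m = 0}
  add_mem' {f g} hf hg m hm := by simp [hf m hm, hg m hm]
  zero_mem' m _ := by simp
  smul_mem' c f hf m hm := by simp [hf m hm]

theorem mul_mem_homog {n a b : ℕ} {f g : NCPoly n} (hf : f ∈ homog n a) (hg : g ∈ homog n b) :
    f * g ∈ homog n (a + b) := by
  classical
  intro m hm
  by_contra hne
  have hmem : m ∈ (f * g).coeff.support := Finsupp.mem_support_iff.2 hne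
  obtain ⟨x, hx, y, hy, rfl⟩ := Finset.mem_mul.1 (MonoidAlgebra.support_coeff_mul_subset f g hmem)
  have h1 : weight x.toList = a := by
    by_contra h
    exact Finsupp.mem_support_iff.1 hx (hf x h)
  have h2 : weight y.toList = b := by
    by_contra h
    exact Finsupp.mem_support_iff.1 hy (hg y h)
  apply hm
  rw [FreeMonoid.toList_mul, weight_append, h1, h2]

theorem ncVar_mem_homog {n : ℕ} (i : Fin (n + 1)) : (ncVar i : NCPoly n) ∈ homog n (genWeight i) := by
  intro m hm
  have : FreeMonoid.of i ≠ m := by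
    rintro rfl
    apply hm
    simp [weight]
  simp [ncVar, MonoidAlgebra.of_apply, MonoidAlgebra.coeff_single, this]

theorem formalComm_mem_homog {n : ℕ} (I : MultiIndex n) (hI : I ≠ []) :
    formalComm I ∈ homog n (weight I) := by
  refine multiIndex_induction (P := fun I => formalComm I ∈ homog n (weight I))
    (fun i => ?_) (fun i I hI ih => ?_) I hI
  · simpa [weight, formalComm_singleton] using ncVar_mem_homog i
  · rw [formalComm_cons i hI, weight_cons]
    refine Submodule.sub_mem _ (mul_mem_homog (ncVar_mem_homog i) ih) ?_
    exact add_comm (weight I) _ ▸ mul_mem_homog ih (ncVar_mem_homog i)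

/-- The span of the formal commutators of weight `w`. -/
def commSpan (n w : ℕ) : Submodule ℝ (NCPoly n) :=
  Submodule.span ℝ (formalComm '' {K : MultiIndex n | K ≠ [] ∧ weight K = w})

theorem formalComm_mem_commSpan {n w : ℕ} {I : MultiIndex n} (hI : I ≠ []) (hw : weight I = w) :
    formalComm I ∈ commSpan n w :=
  Submodule.subset_span ⟨I, ⟨hI, hw⟩, rfl⟩

theorem ncVar_comm_mem_commSpan {n w : ℕ} (i : Fin (n + 1)) {f : NCPoly n}
    (hf : f ∈ commSpan n w) : ncVar i * f - f * ncVar i ∈ commSpan n (genWeight i + w) := by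
  induction hf using Submodule.span_induction with
  | mem x hx =>
    obtain ⟨K, ⟨hK, rfl⟩, rfl⟩ := hx
    rw [← formalComm_cons i hK]
    exact formalComm_mem_commSpan (by simp) (weight_cons i K)
  | zero => simp
  | add x y _ _ hx hy =>
    convert Submodule.add_mem _ hx hy using 1
    noncomm_ring
  | smul c x _ hx =>
    convert Submodule.smul_mem _ c hx using 1
    simp [smul_sub]

/-- Induction on `I` for all `J` at once, by the Jacobi identity `[[ξ_i, a], b] = [ξ_i, [a, b]] -
[a, [ξ_i, b]]`: the last term is the induction hypothesis for the longer index `i :: J`. -/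
theorem formalComm_comm_mem_commSpan {n : ℕ} (I : MultiIndex n) (hI : I ≠ []) :
    ∀ J : MultiIndex n, J ≠ [] →
      formalComm I * formalComm J - formalComm J * formalComm I ∈
        commSpan n (weight I + weight J) := by
  refine multiIndex_induction (P := fun I => ∀ J : MultiIndex n, J ≠ [] →
      formalComm I * formalComm J - formalComm J * formalComm I ∈
        commSpan n (weight I + weight J)) (fun i J hJ => ?_) (fun i I hI ih J hJ => ?_) I hI
  · rw [formalComm_singleton, ← formalComm_cons i hJ]
    exact formalComm_mem_commSpan (by simp) (by simp [weight])
  · have h1 := ncVar_comm_mem_commSpan i (ih J hJ)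
    have h2 := ih (i :: J) (by simp)
    rw [formalComm_cons i hJ] at h2
    rw [formalComm_cons i hI, weight_cons]
    rw [← add_assoc] at h1
    rw [weight_cons, ← add_assoc, add_comm (weight I)] at h2
    convert Submodule.sub_mem _ h1 h2 using 1
    noncomm_ring

theorem sum_single_sub_sum {R ι κ M : Type*} [CommRing R] [AddCommGroup M] [Module R M]
    [Fintype κ] (i : ι) (j : κ → ι) (c : κ → R) (g : ι → M) :
    ((Finsupp.single i 1 - ∑ k, Finsupp.single (j k) (c k) : ι →₀ R).sum fun i t => t • g i) =
      g i - ∑ k, c k • g (j k) := by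
  have h1 : ∀ a : ι →₀ R, (a.sum fun i t => t • g i) = Finsupp.linearCombination R g a :=
    fun a => rfl
  rw [h1, map_sub, map_sum]
  simp [Finsupp.linearCombination_single]

/-- If the fields are free up to weight `r` at a point where `(X_[I])_{I ∈ B}` spans, then each
formal commutator of weight `≤ r` is a combination of those with indices in `B` of the same
weight. -/
theorem exists_formalComm_eq_sum {n : ℕ} {E : Type*} [NormedAddCommGroup E] [NormedSpace ℝ E]
    {X : Fin (n + 1) → E → E} {r : ℕ} {x : E} (hfree : FreeUpTo X r x)
    {B : Finset (MultiIndex n)} (hB : ∀ I ∈ B, I ≠ [] ∧ weight I ≤ r)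
    (hspan : Submodule.span ℝ (Set.range fun I : B => comm X I.1 x) = ⊤)
    {L : MultiIndex n} (hL : L ≠ []) (hLr : weight L ≤ r) :
    ∃ c : B → ℝ, (∀ K, weight K.1 ≠ weight L → c K = 0) ∧
      formalComm L = ∑ K : B, c K • formalComm K.1 := by
  classical
  have hmem : comm X L x ∈ Submodule.span ℝ (Set.range fun I : B => comm X I.1 x) := by
    rw [hspan]; trivial
  obtain ⟨c, hc⟩ := (Submodule.mem_span_range_iff_exists_fun ℝ).1 hmem
  have key : ∀ J : MultiIndex n, univConst L J = ∑ K : B, c K * univConst K.1 J := by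
    intro J
    -- The family encoding the relation `X_[L] - ∑ c_K X_[K] = 0` at `x`; a difference of singletons
    -- also covers the case `L ∈ B`.
    let a : MultiIndex n →₀ ℝ := Finsupp.single L 1 - ∑ K : B, Finsupp.single K.1 (c K)
    have ha : ∀ I ∈ a.support, I ≠ [] ∧ weight I ≤ r := by
      intro I hI
      by_cases h : I = L
      · exact h ▸ ⟨hL, hLr⟩
      by_cases h' : I ∈ B
      · exact hB I h'
      exfalso
      apply Finsupp.mem_support_iff.1 hI
      simp only [a, Finsupp.sub_apply, Finsupp.finsetSum_apply]
      rw [Finsupp.single_apply, if_neg (Ne.symm h), Finset.sum_eq_zero, sub_zero]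
      intro K _
      rw [Finsupp.single_apply, if_neg]
      rintro rfl
      exact h' K.2
    have h0 : (a.sum fun I t => t • comm X I x) = 0 := by
      rw [sum_single_sub_sum, hc, sub_self]
    have h2 := hfree a ha h0 J
    have h3 := sum_single_sub_sum (R := ℝ) L (fun K : B => K.1) c (fun I => univConst I J)
    simp only [smul_eq_mul] at h3
    rw [show (a.sum fun I t => t * univConst I J) = _ from h3] at h2
    exact sub_eq_zero.1 h2
  -- Commutators are homogeneous, so discarding the terms of other weights leaves the coefficients
  -- in weight `|L|` unchanged; in other weights both sides vanish.
  refine ⟨fun K => if weight K.1 = weight L then c K else 0, fun K hK => if_neg hK, ?_⟩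
  apply MonoidAlgebra.coeff_injective
  ext m
  have e := key m.toList
  simp only [univConst, FreeMonoid.ofList_toList] at e
  rw [MonoidAlgebra.coeff_sum, Finsupp.finsetSum_apply]
  simp only [MonoidAlgebra.coeff_smul_apply, smul_eq_mul]
  by_cases hm : weight m.toList = weight L
  · rw [e]
    refine Finset.sum_congr rfl fun K _ => ?_
    split_ifs with h
    · rfl
    · rw [formalComm_mem_homog K.1 (hB K.1 K.2).1 m (fun h' => h (h'.symm.trans hm))]
      simp
  · rw [formalComm_mem_homog L hL m hm]
    symm
    refine Finset.sum_eq_zero fun K _ => ?_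
    split_ifs with h
    · rw [formalComm_mem_homog K.1 (hB K.1 K.2).1 m (fun h' => hm (h'.trans h)), mul_zero]
    · simp

/-- Every formal commutator of weight `≤ r` is a combination of those with indices in `B` of the
same weight. -/
def Generates {n : ℕ} (B : Finset (MultiIndex n)) (r : ℕ) : Prop :=
  ∀ L : MultiIndex n, L ≠ [] → weight L ≤ r →
    ∃ c : B → ℝ, (∀ K, weight K.1 ≠ weight L → c K = 0) ∧
      formalComm L = ∑ K : B, c K • formalComm K.1

theorem Generates.exists_eq_sum {n r : ℕ} {B : Finset (MultiIndex n)} (h : Generates B r) {w : ℕ}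
    (hw : w ≤ r) {f : NCPoly n} (hf : f ∈ commSpan n w) :
    ∃ c : B → ℝ, (∀ K, weight K.1 ≠ w → c K = 0) ∧ f = ∑ K : B, c K • formalComm K.1 := by
  induction hf using Submodule.span_induction with
  | mem x hx =>
    obtain ⟨K, ⟨hK, rfl⟩, rfl⟩ := hx
    exact h K hK hw
  | zero => exact ⟨0, by simp, by simp⟩
  | add x y _ _ hx hy =>
    obtain ⟨c, hc, rfl⟩ := hx
    obtain ⟨d, hd, rfl⟩ := hy
    refine ⟨c + d, fun K hK => by simp [hc K hK, hd K hK], ?_⟩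
    simp [add_smul, Finset.sum_add_distrib]
  | smul t x _ hx =>
    obtain ⟨c, hc, rfl⟩ := hx
    refine ⟨t • c, fun K hK => by simp [hc K hK], ?_⟩
    simp [Finset.smul_sum, mul_smul]

/-! ### Smooth vector fields as a representation of the free algebra. -/

section Fields

variable {E : Type*} [NormedAddCommGroup E] [NormedSpace ℝ E] {Ω : Set E}

theorem contDiffOn_lieBracket (hΩ : IsOpen Ω) {V W : E → E} (hV : ContDiffOn ℝ ∞ V Ω)
    (hW : ContDiffOn ℝ ∞ W Ω) : ContDiffOn ℝ ∞ (VectorField.lieBracket ℝ V W) Ω := fun _ hx =>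
  ((hV.contDiffAt (hΩ.mem_nhds hx)).lieBracket_vectorField
    (hW.contDiffAt (hΩ.mem_nhds hx)) (by simp)).contDiffWithinAt

theorem comm_cons {n : ℕ} (X : Fin (n + 1) → E → E) (i : Fin (n + 1)) {I : MultiIndex n}
    (hI : I ≠ []) : comm X (i :: I) = VectorField.lieBracket ℝ (X i) (comm X I) :=
  nested_cons _ _ i hI

theorem contDiffOn_comm {n : ℕ} {X : Fin (n + 1) → E → E} (hΩ : IsOpen Ω)
    (hX : ∀ i, ContDiffOn ℝ ∞ (X i) Ω) (I : MultiIndex n) : ContDiffOn ℝ ∞ (comm X I) Ω := by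
  by_cases hI : I = []
  · subst hI; exact contDiffOn_const (c := (0 : E))
  · refine multiIndex_induction (P := fun I => ContDiffOn ℝ ∞ (comm X I) Ω) hX
      (fun i I hI ih => ?_) I hI
    rw [comm_cons X i hI]
    exact contDiffOn_lieBracket hΩ (hX i) ih

/-- The real functions that are smooth on `Ω`. -/
def smoothFun (Ω : Set E) : Submodule ℝ (E → ℝ) where
  carrier := {f | ContDiffOn ℝ ∞ f Ω}
  add_mem' hf hg := ContDiffOn.add hf hg
  zero_mem' := contDiffOn_const (c := (0 : ℝ))
  smul_mem' c _ hf := ContDiffOn.const_smul c hf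

theorem contDiffOn_act (hΩ : IsOpen Ω) {Z : E → E} (hZ : ContDiffOn ℝ ∞ Z Ω) {f : E → ℝ}
    (hf : ContDiffOn ℝ ∞ f Ω) : ContDiffOn ℝ ∞ (act Z f) Ω :=
  (hf.fderiv_of_isOpen hΩ (by simp)).clm_apply hZ

/-- A smooth vector field on the open set `Ω` as a linear operator on the smooth functions. -/
def derivOp (hΩ : IsOpen Ω) (Z : E → E) (hZ : ContDiffOn ℝ ∞ Z Ω) :
    Module.End ℝ (smoothFun Ω) where
  -- Off `Ω` the functions need not be differentiable, so linearity there is enforced by truncating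
  -- to zero.
  toFun f := ⟨Ω.indicator (act Z f.1), (contDiffOn_act hΩ hZ f.2).congr fun _ hx =>
    indicator_of_mem hx _⟩
  map_add' f g := by
    ext x
    by_cases hx : x ∈ Ω
    · have hf := (f.2.contDiffAt (hΩ.mem_nhds hx)).differentiableAt (by simp)
      have hg := (g.2.contDiffAt (hΩ.mem_nhds hx)).differentiableAt (by simp)
      simp [hx, act, fderiv_add hf hg]
    · simp [hx]
  map_smul' c f := by
    ext x
    by_cases hx : x ∈ Ω
    · have hf := (f.2.contDiffAt (hΩ.mem_nhds hx)).differentiableAt (by simp)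
      simp [hx, act, fderiv_const_smul hf]
    · simp [hx]

theorem derivOp_apply (hΩ : IsOpen Ω) {Z : E → E} (hZ : ContDiffOn ℝ ∞ Z Ω) (f : smoothFun Ω)
    {x : E} (hx : x ∈ Ω) : (derivOp hΩ Z hZ f).1 x = fderiv ℝ f.1 x (Z x) :=
  indicator_of_mem hx _

theorem derivOp_lieBracket (hΩ : IsOpen Ω) {V W : E → E} (hV : ContDiffOn ℝ ∞ V Ω)
    (hW : ContDiffOn ℝ ∞ W Ω) :
    derivOp hΩ (VectorField.lieBracket ℝ V W) (contDiffOn_lieBracket hΩ hV hW) =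
      derivOp hΩ V hV * derivOp hΩ W hW - derivOp hΩ W hW * derivOp hΩ V hV := by
  ext f x
  by_cases hx : x ∈ Ω
  · have hn := hΩ.mem_nhds hx
    have key : ∀ {Z : E → E} (hZ : ContDiffOn ℝ ∞ Z Ω),
        fderiv ℝ (derivOp hΩ Z hZ f).1 x = fderiv ℝ (fun y => fderiv ℝ f.1 y (Z y)) x := by
      intro Z hZ
      apply Filter.EventuallyEq.fderiv_eq
      filter_upwards [hn] with y hy
      exact derivOp_apply hΩ hZ f hy
    rw [derivOp_apply hΩ _ f hx, VectorField.fderiv_apply_lieBracket (n := 2)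
      ((f.2.contDiffAt hn).of_le (mod_cast ENat.LEInfty.out)) (by simp)
      ((hW.contDiffAt hn).differentiableAt (by simp))
      ((hV.contDiffAt hn).differentiableAt (by simp)), ← key hV, ← key hW]
    change _ = (derivOp hΩ V hV (derivOp hΩ W hW f)).1 x - (derivOp hΩ W hW (derivOp hΩ V hV f)).1 x
    rw [derivOp_apply hΩ hV _ hx, derivOp_apply hΩ hW _ hx]
  · have : ∀ {Z : E → E} (hZ : ContDiffOn ℝ ∞ Z Ω) (g : smoothFun Ω),
        (derivOp hΩ Z hZ g).1 x = 0 := fun hZ g => indicator_of_notMem hx _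
    change (derivOp hΩ _ _ f).1 x =
      (derivOp hΩ V hV (derivOp hΩ W hW f)).1 x - (derivOp hΩ W hW (derivOp hΩ V hV f)).1 x
    simp [this]

variable {n : ℕ} {X : Fin (n + 1) → E → E}

/-- The representation of the noncommutative polynomials by differential operators. -/
def ncRep (hΩ : IsOpen Ω) (hX : ∀ i, ContDiffOn ℝ ∞ (X i) Ω) :
    NCPoly n →ₐ[ℝ] Module.End ℝ (smoothFun Ω) :=
  MonoidAlgebra.lift ℝ _ _ (FreeMonoid.lift fun i => derivOp hΩ (X i) (hX i))

theorem ncRep_formalComm (hΩ : IsOpen Ω) (hX : ∀ i, ContDiffOn ℝ ∞ (X i) Ω) (I : MultiIndex n)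
    (hI : I ≠ []) :
    ncRep hΩ hX (formalComm I) = derivOp hΩ (comm X I) (contDiffOn_comm hΩ hX I) := by
  have h1 : ∀ i, ncRep hΩ hX (ncVar i) = derivOp hΩ (X i) (hX i) := by
    intro i
    rw [ncRep, ncVar, MonoidAlgebra.lift_of, FreeMonoid.lift_eval_of]
  refine multiIndex_induction (P := fun I => ncRep hΩ hX (formalComm I) =
    derivOp hΩ (comm X I) (contDiffOn_comm hΩ hX I)) h1 (fun i I hI ih => ?_) I hI
  rw [formalComm_cons i hI, map_sub, map_mul, map_mul, h1, ih, ← derivOp_lieBracket]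
  congr 1
  exact (comm_cons X i hI).symm

/-- Applying the operators to continuous linear functionals recovers the fields, because these
functionals separate points. -/
theorem eq_zero_of_derivOp (hΩ : IsOpen Ω) {κ : Type*} [Fintype κ] {Z : E → E}
    (hZ : ContDiffOn ℝ ∞ Z Ω) (c : κ → ℝ) {W : κ → E → E} (hW : ∀ k, ContDiffOn ℝ ∞ (W k) Ω)
    (h : derivOp hΩ Z hZ = ∑ k, c k • derivOp hΩ (W k) (hW k)) {x : E} (hx : x ∈ Ω) :
    Z x = ∑ k, c k • W k x := by
  refine (SeparatingDual.eq_iff_forall_dual_eq (R := ℝ)).2 fun l => ?_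
  let f : smoothFun Ω := ⟨l, l.contDiff.contDiffOn⟩
  have h1 := congrArg (fun T : Module.End ℝ (smoothFun Ω) => (T f).1 x) h
  simp only [LinearMap.sum_apply, LinearMap.smul_apply, AddSubmonoidClass.coe_finsetSum,
    Finset.sum_apply, SetLike.val_smul, Pi.smul_apply, derivOp_apply hΩ _ f hx] at h1
  simpa [f] using h1

/-- The image of the formal identity under `ncRep`. Neither freeness nor a basis enters, so it
transfers relations found from `X` to the system `Y`. -/
theorem comm_eq_sum (hΩ : IsOpen Ω) (hX : ∀ i, ContDiffOn ℝ ∞ (X i) Ω) {L : MultiIndex n}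
    (hL : L ≠ []) {B : Finset (MultiIndex n)} (hB : ∀ I ∈ B, I ≠ []) {c : B → ℝ}
    (h : formalComm L = ∑ K : B, c K • formalComm K.1) {x : E} (hx : x ∈ Ω) :
    comm X L x = ∑ K : B, c K • comm X K.1 x := by
  refine eq_zero_of_derivOp hΩ (contDiffOn_comm hΩ hX L) c
    (fun K : B => contDiffOn_comm hΩ hX K.1) ?_ hx
  have h1 := congrArg (ncRep hΩ hX) h
  rw [ncRep_formalComm hΩ hX L hL, map_sum] at h1
  rw [h1]
  refine Finset.sum_congr rfl fun K _ => ?_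
  rw [map_smul, ncRep_formalComm hΩ hX K.1 (hB K.1 K.2)]

theorem lieBracket_comm_eq_sum (hΩ : IsOpen Ω) (hX : ∀ i, ContDiffOn ℝ ∞ (X i) Ω)
    {I J : MultiIndex n} (hI : I ≠ []) (hJ : J ≠ []) {B : Finset (MultiIndex n)}
    (hB : ∀ I ∈ B, I ≠ []) {c : B → ℝ}
    (h : formalComm I * formalComm J - formalComm J * formalComm I =
      ∑ K : B, c K • formalComm K.1) {x : E} (hx : x ∈ Ω) :
    VectorField.lieBracket ℝ (comm X I) (comm X J) x = ∑ K : B, c K • comm X K.1 x := by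
  refine eq_zero_of_derivOp hΩ (contDiffOn_lieBracket hΩ (contDiffOn_comm hΩ hX I)
    (contDiffOn_comm hΩ hX J)) c (fun K : B => contDiffOn_comm hΩ hX K.1) ?_ hx
  have h1 := congrArg (ncRep hΩ hX) h
  rw [map_sub, map_mul, map_mul, ncRep_formalComm hΩ hX I hI, ncRep_formalComm hΩ hX J hJ,
    map_sum] at h1
  rw [derivOp_lieBracket hΩ (contDiffOn_comm hΩ hX I) (contDiffOn_comm hΩ hX J), h1]
  refine Finset.sum_congr rfl fun K _ => ?_
  rw [map_smul, ncRep_formalComm hΩ hX K.1 (hB K.1 K.2)]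

end Fields

/-! ### Weights of Taylor expansions, truncated by degree. -/

section Weights

set_option linter.unusedSectionVars false

variable {ι : Type*} [Fintype ι]

/-- The function is smooth on a neighbourhood of the origin. -/
def SmoothNear {F : Type*} [NormedAddCommGroup F] [NormedSpace ℝ F] (f : (ι → ℝ) → F) : Prop :=
  ∀ᶠ u in 𝓝 (0 : ι → ℝ), ContDiffAt ℝ ∞ f u

namespace SmoothNear

variable {F : Type*} [NormedAddCommGroup F] [NormedSpace ℝ F] {f g : (ι → ℝ) → F}

theorem add (hf : SmoothNear f) (hg : SmoothNear g) : SmoothNear fun u => f u + g u := by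
  filter_upwards [hf, hg] with u h1 h2 using h1.add h2

theorem sub (hf : SmoothNear f) (hg : SmoothNear g) : SmoothNear fun u => f u - g u := by
  filter_upwards [hf, hg] with u h1 h2 using h1.sub h2

theorem neg (hf : SmoothNear f) : SmoothNear fun u => -f u := by
  filter_upwards [hf] with u h1 using h1.neg

theorem mul {f g : (ι → ℝ) → ℝ} (hf : SmoothNear f) (hg : SmoothNear g) :
    SmoothNear fun u => f u * g u := by
  filter_upwards [hf, hg] with u h1 h2 using h1.mul h2

theorem sum {κ : Type*} {s : Finset κ} {f : κ → (ι → ℝ) → F} (hf : ∀ k ∈ s, SmoothNear (f k)) :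
    SmoothNear fun u => ∑ k ∈ s, f k u := by
  filter_upwards [(Filter.eventually_all_finset s).2 hf] with u h using ContDiffAt.sum h

theorem const (c : F) : SmoothNear (ι := ι) fun _ => c := Eventually.of_forall fun _ =>
  contDiffAt_const

theorem coord (i : ι) : SmoothNear fun u : ι → ℝ => u i := Eventually.of_forall fun _ =>
  contDiffAt_pi.1 contDiffAt_id i

theorem differentiableAt (hf : SmoothNear f) : ∀ᶠ u in 𝓝 0, DifferentiableAt ℝ f u := by
  filter_upwards [hf] with u h using h.differentiableAt (by simp)

theorem fderiv (hf : SmoothNear f) : SmoothNear (fderiv ℝ f) := by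
  filter_upwards [hf] with u h using h.fderiv_right (by simp)

theorem apply {κ : Type*} [Fintype κ] {f : (ι → ℝ) → κ → ℝ} (hf : SmoothNear f) (k : κ) :
    SmoothNear fun u => f u k := by
  filter_upwards [hf] with u h using contDiffAt_pi.1 h k

end SmoothNear

variable [DecidableEq ι]

/-- The partial derivative in the direction of the coordinate `i`. -/
def partialD (i : ι) (f : (ι → ℝ) → ℝ) (u : ι → ℝ) : ℝ := fderiv ℝ f u (Pi.single i 1)

theorem SmoothNear.partialD {f : (ι → ℝ) → ℝ} (hf : SmoothNear f) (i : ι) :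
    SmoothNear (partialD i f) := by
  filter_upwards [hf.fderiv] with u h using h.clm_apply contDiffAt_const

/-- The Taylor coefficients of `f` at `0` of degree `< k` and weight `< s` vanish. -/
def WeightGE (w : ι → ℕ) : ℕ → ((ι → ℝ) → ℝ) → ℤ → Prop
  | 0, _, _ => True
  | k + 1, f, s => (0 < s → f 0 = 0) ∧ ∀ i, WeightGE w k (partialD i f) (s - w i)

namespace WeightGE

variable {w : ι → ℕ} {k : ℕ} {f g : (ι → ℝ) → ℝ} {s t : ℤ}

theorem congr (h : WeightGE w k f s) (hfg : f =ᶠ[𝓝 0] g) : WeightGE w k g s := by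
  induction k generalizing f g s with
  | zero => trivial
  | succ k ih =>
    refine ⟨fun hs => hfg.eq_of_nhds ▸ h.1 hs, fun i => ih (h.2 i) ?_⟩
    filter_upwards [hfg.fderiv (𝕜 := ℝ)] with u hu
    simp [partialD, hu]

theorem mono (h : WeightGE w k f s) (hts : t ≤ s) : WeightGE w k f t := by
  induction k generalizing f s t with
  | zero => trivial
  | succ k ih => exact ⟨fun ht => h.1 (ht.trans_le hts), fun i => ih (h.2 i) (by omega)⟩

theorem of_succ (h : WeightGE w (k + 1) f s) : WeightGE w k f s := by
  induction k generalizing f s with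
  | zero => trivial
  | succ k ih => exact ⟨h.1, fun i => ih (h.2 i)⟩

theorem of_nonpos (hs : s ≤ 0) : WeightGE w k f s := by
  induction k generalizing f s with
  | zero => trivial
  | succ k ih => exact ⟨fun h => absurd hs (not_le.2 h), fun i => ih (by omega)⟩

theorem add (hf : WeightGE w k f s) (hg : WeightGE w k g s) (sf : SmoothNear f)
    (sg : SmoothNear g) : WeightGE w k (fun u => f u + g u) s := by
  induction k generalizing f g s with
  | zero => trivial
  | succ k ih =>
    refine ⟨fun hs => by simp [hf.1 hs, hg.1 hs], fun i =>
      (ih (hf.2 i) (hg.2 i) (sf.partialD i) (sg.partialD i)).congr ?_⟩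
    filter_upwards [sf.differentiableAt, sg.differentiableAt] with u h1 h2
    simp [partialD, fderiv_fun_add h1 h2]

theorem const_mul (hf : WeightGE w k f s) (sf : SmoothNear f) (c : ℝ) :
    WeightGE w k (fun u => c * f u) s := by
  induction k generalizing f s with
  | zero => trivial
  | succ k ih =>
    refine ⟨fun hs => by simp [hf.1 hs], fun i => (ih (hf.2 i) (sf.partialD i)).congr ?_⟩
    filter_upwards [sf.differentiableAt] with u h1
    simp [partialD, fderiv_const_mul h1]

theorem neg (hf : WeightGE w k f s) (sf : SmoothNear f) : WeightGE w k (fun u => -f u) s := by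
  simpa using hf.const_mul sf (-1)

theorem sub (hf : WeightGE w k f s) (hg : WeightGE w k g s) (sf : SmoothNear f)
    (sg : SmoothNear g) : WeightGE w k (fun u => f u - g u) s := by
  simpa [sub_eq_add_neg] using hf.add (hg.neg sg) sf sg.neg

theorem zero : WeightGE w k (fun _ => 0) s := by
  induction k generalizing s with
  | zero => trivial
  | succ k ih =>
    exact ⟨fun _ => rfl, fun i =>
      (ih (s := s - w i)).congr (Eventually.of_forall fun u => by simp [partialD])⟩

theorem sum {κ : Type*} {T : Finset κ} {f : κ → (ι → ℝ) → ℝ}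
    (hf : ∀ j ∈ T, WeightGE w k (f j) s) (sf : ∀ j ∈ T, SmoothNear (f j)) :
    WeightGE w k (fun u => ∑ j ∈ T, f j u) s := by
  classical
  induction T using Finset.induction_on with
  | empty => simpa using zero
  | insert a T ha ih =>
    simp only [Finset.sum_insert ha]
    exact (hf a (by simp)).add (ih (fun j hj => hf j (by simp [hj]))
      fun j hj => sf j (by simp [hj])) (sf a (by simp)) (SmoothNear.sum fun j hj => sf j (by simp [hj]))

theorem partialD_mul (sf : SmoothNear f) (sg : SmoothNear g) (i : ι) :
    (fun u => f u * partialD i g u + partialD i f u * g u) =ᶠ[𝓝 0]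
      partialD i fun u => f u * g u := by
  filter_upwards [sf.differentiableAt, sg.differentiableAt] with u h1 h2
  simp [partialD, fderiv_fun_mul h1 h2, mul_comm]

theorem mul (hf : WeightGE w k f s) (hg : WeightGE w k g t) (sf : SmoothNear f)
    (sg : SmoothNear g) : WeightGE w k (fun u => f u * g u) (s + t) := by
  induction k generalizing f g s t with
  | zero => trivial
  | succ k ih =>
    refine ⟨fun hs => ?_, fun i => WeightGE.congr ?_ (partialD_mul sf sg i)⟩
    · rcases lt_or_ge 0 s with h | h
      · simp [hf.1 h]
      · simp [hg.1 (by omega)]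
    · refine add ?_ ?_ (sf.mul (sg.partialD i)) ((sf.partialD i).mul sg)
      · exact (ih hf.of_succ (hg.2 i) sf (sg.partialD i)).mono (by omega)
      · exact (ih (hf.2 i) hg.of_succ (sf.partialD i) sg).mono (by omega)

/-- If `g 0 = 0` then the product with `g` gains one degree of precision. -/
theorem mul_of_apply_zero (hf : WeightGE w k f s) (hg : WeightGE w (k + 1) g t) (g0 : g 0 = 0)
    (sf : SmoothNear f) (sg : SmoothNear g) : WeightGE w (k + 1) (fun u => f u * g u) (s + t) := by
  induction k generalizing f s with
  | zero => exact ⟨fun _ => by simp [g0], fun _ => trivial⟩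
  | succ k ih =>
    refine ⟨fun _ => by simp [g0], fun i => WeightGE.congr ?_ (partialD_mul sf sg i)⟩
    -- After one differentiation only degree `k + 1` is needed. The term with `∂_i g` needs no
    -- vanishing; in the one with `∂_i f` the factor `g` still vanishes at `0`, so induction
    -- applies.
    refine add ?_ ?_ (sf.mul (sg.partialD i)) ((sf.partialD i).mul sg)
    · exact (hf.mul (hg.2 i) sf (sg.partialD i)).mono (by omega)
    · exact (ih (hf.2 i) hg.of_succ (sf.partialD i)).mono (by omega)

/-- In a product of two factors without constant term, each factor enters only in degrees strictly
below that of the product. This makes the quadratic term of the Euler equation accessible to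
induction on the degree. -/
theorem mul_of_apply_zero_of_apply_zero (hf : WeightGE w (k + 1) f s) (hg : WeightGE w (k + 1) g t)
    (f0 : f 0 = 0) (g0 : g 0 = 0) (sf : SmoothNear f) (sg : SmoothNear g) :
    WeightGE w (k + 2) (fun u => f u * g u) (s + t) := by
  refine ⟨fun _ => by simp [g0], fun i => WeightGE.congr ?_ (partialD_mul sf sg i)⟩
  refine add ?_ ?_ (sf.mul (sg.partialD i)) ((sf.partialD i).mul sg)
  · refine WeightGE.mono (s := (t - w i) + s) ?_ (by omega)
    simpa [mul_comm] using mul_of_apply_zero (hg.2 i) hf f0 (sg.partialD i) sf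
  · exact (mul_of_apply_zero (hf.2 i) hg g0 (sf.partialD i) sg).mono (by omega)

theorem coord (i : ι) : WeightGE w k (fun u => u i) (w i) := by
  cases k with
  | zero => trivial
  | succ k =>
    refine ⟨fun _ => rfl, fun j => ?_⟩
    have h : partialD j (fun u : ι → ℝ => u i) = fun _ => (Pi.single j 1 : ι → ℝ) i := by
      ext u
      have : (fun u : ι → ℝ => u i) = ContinuousLinearMap.proj (R := ℝ) (φ := fun _ : ι => ℝ) i := rfl
      rw [partialD, this, ContinuousLinearMap.fderiv]
      rfl
    rw [h]
    by_cases hij : j = i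
    · subst hij; exact of_nonpos (by omega)
    · simpa [Pi.single_apply, Ne.symm hij] using zero

theorem coord_mul (hf : WeightGE w k f s) (sf : SmoothNear f) (i : ι) :
    WeightGE w (k + 1) (fun u => u i * f u) (w i + s) := by
  simpa [mul_comm, add_comm] using mul_of_apply_zero hf (coord i) rfl sf (SmoothNear.coord i)

/-- The operator `E + m`, with `E` the Euler field and `m > 0`, reflects weights. -/
theorem of_euler_add {m : ℝ} (hm : 0 < m) (sf : SmoothNear f)
    (h : WeightGE w k (fun u => fderiv ℝ f u u + m * f u) s) : WeightGE w k f s := by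
  induction k generalizing f s m with
  | zero => trivial
  | succ k ih =>
    -- Here `∂_i (𝓔 + m) = (𝓔 + m + 1) ∂_i` for the Euler field `𝓔`, so the induction must let `m`
    -- vary; at the origin `𝓔 f` vanishes and `m ≠ 0` suffices.
    refine ⟨fun hs => ?_, fun i => ih (m := m + 1) (by positivity) (sf.partialD i)
      ((h.2 i).congr ?_)⟩
    · have h0 := h.1 hs
      simp only [map_zero, zero_add, mul_eq_zero] at h0
      exact h0.resolve_left hm.ne'
    · filter_upwards [sf, sf.differentiableAt, sf.fderiv.differentiableAt] with u h1 h2 h3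
      have hsymm : fderiv ℝ (fderiv ℝ f) u (Pi.single i 1) u =
          fderiv ℝ (fderiv ℝ f) u u (Pi.single i 1) :=
        (h1.isSymmSndFDerivAt (by simpa using mod_cast ENat.LEInfty.out)) _ _
      have e1 : HasFDerivAt (fun v => fderiv ℝ f v v + m * f v)
          ((fderiv ℝ f u).comp (ContinuousLinearMap.id ℝ _) +
            (fderiv ℝ (fderiv ℝ f) u).flip u + m • fderiv ℝ f u) u :=
        (h3.hasFDerivAt.clm_apply (hasFDerivAt_id u)).add (h2.hasFDerivAt.const_mul m)
      have e2 : HasFDerivAt (partialD i f)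
          ((fderiv ℝ (fderiv ℝ f) u).flip (Pi.single i 1)) u := by
        have h4 := h3.hasFDerivAt.clm_apply (hasFDerivAt_const (Pi.single i (1 : ℝ)) u)
        rw [ContinuousLinearMap.comp_zero, zero_add] at h4
        exact h4
      rw [e2.fderiv]
      simp only [partialD]
      rw [e1.fderiv]
      simp [hsymm]
      ring

theorem iteratedFDeriv_eq_zero (h : WeightGE w (k + 1) f s) (sf : SmoothNear f) (K : Fin k → ι)
    (hK : (∑ j, (w (K j) : ℤ)) < s) :
    iteratedFDeriv ℝ k f 0 (fun j => Pi.single (K j) (1 : ℝ)) = 0 := by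
  induction k generalizing f s with
  | zero =>
    rw [iteratedFDeriv_zero_apply]
    exact h.1 (by simpa using hK)
  | succ k ih =>
    rw [Fin.sum_univ_castSucc] at hK
    have h1 := ih (h.2 (K (Fin.last k))) (sf.partialD _) (fun j => K j.castSucc) (by omega)
    rw [iteratedFDeriv_succ_apply_right]
    have h2 : partialD (K (Fin.last k)) f = fun u =>
      ContinuousLinearMap.apply ℝ ℝ (Pi.single (K (Fin.last k)) (1 : ℝ) : ι → ℝ) (fderiv ℝ f u) := rfl
    have h3 := ContinuousLinearMap.iteratedFDeriv_comp_left
      (ContinuousLinearMap.apply ℝ ℝ (Pi.single (K (Fin.last k)) (1 : ℝ) : ι → ℝ))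
      (f := fderiv ℝ f) (x := 0) (n := ∞) (sf.fderiv.self_of_nhds) (i := k)
      (WithTop.coe_le_coe.2 le_top)
    rw [h2] at h1
    erw [h3] at h1
    exact h1

end WeightGE

end Weights

/-! ### Euler frames and the recursion for their Taylor coefficients. -/

section Frames

set_option linter.unusedSectionVars false

variable {ι : Type*} [Fintype ι] [DecidableEq ι]

/-- A frame `(W_I)` near `0` in which the Euler field is `∑ u_I W_I` and whose brackets of weight
`≤ r` have the constant structure coefficients `c`. -/
structure EulerFrame (w : ι → ℕ) (r : ℕ) (c : ι → ι → ι → ℝ) (W : ι → (ι → ℝ) → ι → ℝ) :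
    Prop where
  smooth : ∀ J, SmoothNear (W J)
  euler : ∀ᶠ u in 𝓝 (0 : ι → ℝ), ∑ I, u I • W I u = u
  bracket : ∀ J I, w J + w I ≤ r →
    ∀ᶠ u in 𝓝 (0 : ι → ℝ), VectorField.lieBracket ℝ (W J) (W I) u = ∑ L, c J I L • W L u

namespace EulerFrame

variable {w : ι → ℕ} {r : ℕ} {c : ι → ι → ι → ℝ} {W W' : ι → (ι → ℝ) → ι → ℝ}

/-- The matrix `W - 1` of the frame relative to the coordinate fields. -/
def defect (W : ι → (ι → ℝ) → ι → ℝ) (J K : ι) (u : ι → ℝ) : ℝ :=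
  W J u K - (Pi.single J 1 : ι → ℝ) K

/-- The derivative of the Euler identity at `0` in the direction `e_J`. -/
theorem apply_zero (h : EulerFrame w r c W) (J : ι) : W J 0 = Pi.single J 1 := by
  have e1 : HasFDerivAt (fun u : ι → ℝ => ∑ I, u I • W I u)
      (∑ I, ((0 : ι → ℝ) I • fderiv ℝ (W I) 0 +
        (ContinuousLinearMap.proj (R := ℝ) (φ := fun _ : ι => ℝ) I).smulRight (W I 0))) 0 := by
    refine HasFDerivAt.fun_sum fun I _ => ?_
    exact (ContinuousLinearMap.proj (R := ℝ) (φ := fun _ : ι => ℝ) I).hasFDerivAt.smul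
      (h.smooth I).differentiableAt.self_of_nhds.hasFDerivAt
  have e2 := (e1.congr_of_eventuallyEq (h.euler.mono fun u hu => hu.symm)).unique
    (hasFDerivAt_id (0 : ι → ℝ))
  have e3 := congrArg (fun T : (ι → ℝ) →L[ℝ] (ι → ℝ) => T (Pi.single J 1)) e2
  simpa [Pi.single_apply, Finset.sum_ite_eq] using e3

theorem defect_zero (h : EulerFrame w r c W) (J K : ι) : defect W J K 0 = 0 := by
  simp [defect, h.apply_zero]

theorem smooth_defect (h : EulerFrame w r c W) (J K : ι) : SmoothNear (defect W J K) :=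
  ((h.smooth J).apply K).sub (SmoothNear.const _)

theorem smooth_bracket (h : EulerFrame w r c W) (J I : ι) :
    SmoothNear (VectorField.lieBracket ℝ (W J) (W I)) := by
  filter_upwards [h.smooth J, h.smooth I] with u h1 h2 using h1.lieBracket_vectorField h2 (by simp)

/-- Differentiating `∑ u_I W_I = u` along `W_J` gives `∑ u_I DW_I(W_J) + ∑ (W_J)_I W_I = W_J`.
Moreover `∑ u_I DW_J(W_I) = DW_J(u)`, again by the Euler identity; subtracting produces the
brackets, and `W = 1 + D` gives the stated form. -/
theorem euler_defect (h : EulerFrame w r c W) (J K : ι) :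
    ∀ᶠ u in 𝓝 (0 : ι → ℝ), fderiv ℝ (defect W J K) u u + 1 * defect W J K u =
      -(∑ L, defect W J L u * defect W L K u) -
        ∑ I, u I * VectorField.lieBracket ℝ (W J) (W I) u K := by
  have hd : ∀ᶠ u in 𝓝 (0 : ι → ℝ), ∀ I, DifferentiableAt ℝ (W I) u :=
    Filter.eventually_all.2 fun I => (h.smooth I).differentiableAt
  filter_upwards [hd, h.euler.eventually_nhds] with u hu he
  have e1 : HasFDerivAt (fun u : ι → ℝ => ∑ I, u I • W I u)
      (∑ I, (u I • fderiv ℝ (W I) u +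
        (ContinuousLinearMap.proj (R := ℝ) (φ := fun _ : ι => ℝ) I).smulRight (W I u))) u := by
    refine HasFDerivAt.fun_sum fun I _ => ?_
    exact (ContinuousLinearMap.proj (R := ℝ) (φ := fun _ : ι => ℝ) I).hasFDerivAt.smul
      (hu I).hasFDerivAt
  have e2 := (e1.congr_of_eventuallyEq (he.mono fun u hu => hu.symm)).unique
    (hasFDerivAt_id (u : ι → ℝ))
  have e3 := congrArg (fun T : (ι → ℝ) →L[ℝ] (ι → ℝ) => T (W J u) K) e2
  have e4 : fderiv ℝ (defect W J K) u u = fderiv ℝ (W J) u u K := by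
    have := ((ContinuousLinearMap.proj (R := ℝ) (φ := fun _ : ι => ℝ) K).hasFDerivAt.comp u
      (hu J).hasFDerivAt).sub_const ((Pi.single J 1 : ι → ℝ) K)
    have := this.fderiv
    exact congrArg (fun T : (ι → ℝ) →L[ℝ] ℝ => T u) this
  have e5 : ∑ I, u I * fderiv ℝ (W J) u (W I u) K = fderiv ℝ (W J) u u K := by
    have := congrArg (fun v => fderiv ℝ (W J) u v K) he.self_of_nhds
    simpa [map_sum, Finset.sum_apply] using this
  simp only [Finset.sum_apply, add_apply, sum_apply, smul_apply, Pi.add_apply, Pi.smul_apply,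
    smul_eq_mul, ContinuousLinearMap.smulRight_apply, ContinuousLinearMap.proj_apply,
    ContinuousLinearMap.id_apply, Finset.sum_add_distrib] at e3
  have e6 : ∑ L, defect W J L u * defect W L K u =
      (∑ L, W J u L * W L u K) - 2 * W J u K + (Pi.single J 1 : ι → ℝ) K := by
    simp only [defect, sub_mul, mul_sub, Finset.sum_sub_distrib]
    simp [Pi.single_apply, Finset.sum_ite_eq]
    ring
  have e7 : ∑ I, u I * VectorField.lieBracket ℝ (W J) (W I) u K =
      (∑ I, u I * fderiv ℝ (W I) u (W J u) K) - ∑ I, u I * fderiv ℝ (W J) u (W I u) K := by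
    simp [VectorField.lieBracket_eq, mul_sub, Finset.sum_sub_distrib]
  rw [e4, e6, e7, e5]
  simp only [defect]
  linarith

/-- Near `0` every smooth field is a combination of the frame with smooth coefficients. -/
theorem exists_coeff (h : EulerFrame w r c W) {b : (ι → ℝ) → ι → ℝ} (hb : SmoothNear b) :
    ∃ a : ι → (ι → ℝ) → ℝ, (∀ L, SmoothNear (a L)) ∧
      ∀ᶠ u in 𝓝 (0 : ι → ℝ), b u = ∑ L, a L u • W L u := by
  -- The operator `v ↦ ∑ v_L W_L(u)` is the identity at `u = 0`, hence invertible nearby; the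
  -- coefficients are `A(u)⁻¹ b(u)`.
  let A : (ι → ℝ) → (ι → ℝ) →L[ℝ] (ι → ℝ) := fun u =>
    ∑ L, (ContinuousLinearMap.proj (R := ℝ) (φ := fun _ : ι => ℝ) L).smulRight (W L u)
  have hA : SmoothNear A := by
    refine SmoothNear.sum fun L _ => ?_
    filter_upwards [h.smooth L] with u hu
    exact ((ContinuousLinearMap.smulRightL ℝ (ι → ℝ) (ι → ℝ)
      (ContinuousLinearMap.proj (R := ℝ) (φ := fun _ : ι => ℝ) L)).contDiff.contDiffAt).comp u hu
  have hA0 : A 0 = ContinuousLinearMap.id ℝ _ := by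
    ext v K
    simp [A, h.apply_zero, Finset.sum_apply, Pi.single_apply]
  have hinv : ∀ᶠ u in 𝓝 (0 : ι → ℝ), A u ∈ range ((↑) : ((ι → ℝ) ≃L[ℝ] (ι → ℝ)) → _) := by
    refine hA.self_of_nhds.continuousAt (ContinuousLinearEquiv.isOpen.mem_nhds ?_)
    rw [hA0]
    exact ⟨ContinuousLinearEquiv.refl ℝ _, rfl⟩
  refine ⟨fun L u => (A u).inverse (b u) L, fun L => ?_, ?_⟩
  · refine SmoothNear.apply (f := fun u => (A u).inverse (b u)) ?_ L
    filter_upwards [hA, hinv, hb] with u h1 h2 h3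
    obtain ⟨e, he⟩ := h2
    have : ContDiffAt ℝ ∞ ContinuousLinearMap.inverse (A u) := he ▸ contDiffAt_map_inverse e
    exact (this.comp u h1).clm_apply h3
  · filter_upwards [hinv] with u h2
    obtain ⟨e, he⟩ := h2
    have h3 : A u ((A u).inverse (b u)) = b u := by
      rw [← he]; simp
    conv_lhs => rw [← h3]
    simp only [A, sum_apply, ContinuousLinearMap.smulRight_apply, ContinuousLinearMap.proj_apply]

/-- The identity matrix contributes only for `K = L`, where the required weight is `0`. -/
theorem weight_frame {k : ℕ} (h : EulerFrame w r c W) {L K : ι}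
    (hk : WeightGE w k (defect W L K) ((w K : ℤ) - w L)) :
    WeightGE w k (fun u => W L u K) ((w K : ℤ) - w L) := by
  have h1 : WeightGE w k (fun _ => (Pi.single L 1 : ι → ℝ) K) ((w K : ℤ) - w L) := by
    by_cases hKL : K = L
    · subst hKL; exact WeightGE.of_nonpos (by omega)
    · simpa [Pi.single_apply, hKL] using WeightGE.zero
  simpa [defect] using hk.add h1 (h.smooth_defect L K) (SmoothNear.const _)

/-- No structure constants are available here, but all frame weights are at most `r`. Any
combination with smooth coefficients thus has `K`-component of weight `≥ w_K - r`, and the factor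
`u_I` raises this to `w_I + w_K - r ≥ 1 + w_K - w_J`. -/
theorem weight_bracket_of_lt {k : ℕ} (h : EulerFrame w r c W) (hw : ∀ I, w I ≤ r) {J I : ι}
    (hJI : r < w J + w I) (hk : ∀ L K, WeightGE w k (defect W L K) ((w K : ℤ) - w L)) (K : ι) :
    WeightGE w (k + 1) (fun u => u I * VectorField.lieBracket ℝ (W J) (W I) u K)
      (1 + (w K : ℤ) - w J) := by
  obtain ⟨a, ha, hab⟩ := h.exists_coeff (h.smooth_bracket J I)
  have h1 : ∀ L ∈ Finset.univ, WeightGE w k (fun u => a L u * W L u K) ((w K : ℤ) - r) := by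
    intro L _
    have := hw L
    exact ((WeightGE.of_nonpos le_rfl).mul (h.weight_frame (hk L K)) (ha L)
      ((h.smooth L).apply K)).mono (by omega)
  have s1 : ∀ L ∈ Finset.univ, SmoothNear fun u => a L u * W L u K :=
    fun L _ => (ha L).mul ((h.smooth L).apply K)
  refine WeightGE.mono (s := (w I : ℤ) + ((w K : ℤ) - r)) ?_ (by omega)
  refine WeightGE.congr (WeightGE.coord_mul (WeightGE.sum h1 s1) (SmoothNear.sum s1) I) ?_
  filter_upwards [hab] with u hu
  simp [hu]

/-- The frame field `W_J` has weight `≥ -w_J`. -/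
theorem weight_defect (h : EulerFrame w r c W) (hw : ∀ I, w I ≤ r)
    (hc : ∀ J I L, w J + w I ≤ r → w L ≠ w J + w I → c J I L = 0) (k : ℕ) :
    ∀ J K, WeightGE w (k + 1) (defect W J K) ((w K : ℤ) - w J) := by
  induction k with
  | zero => exact fun J K => ⟨fun _ => h.defect_zero J K, fun _ => trivial⟩
  | succ k ih =>
    intro J K
    -- By the Euler equation it suffices to bound the right side up to degree `k + 1`, which
    -- involves the defects only up to degree `k`.
    refine WeightGE.of_euler_add one_pos (h.smooth_defect J K)
      (WeightGE.congr ?_ ((h.euler_defect J K).mono fun u hu => hu.symm))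
    have s1 : ∀ L ∈ Finset.univ, SmoothNear fun u => defect W J L u * defect W L K u :=
      fun L _ => (h.smooth_defect J L).mul (h.smooth_defect L K)
    have s2 : ∀ I ∈ Finset.univ, SmoothNear fun u : ι → ℝ =>
        u I * VectorField.lieBracket ℝ (W J) (W I) u K :=
      fun I _ => (SmoothNear.coord I).mul ((h.smooth_bracket J I).apply K)
    refine WeightGE.sub (WeightGE.neg (WeightGE.sum (fun L _ => ?_) s1) (SmoothNear.sum s1))
      (WeightGE.sum (fun I _ => ?_) s2) (SmoothNear.sum s1).neg (SmoothNear.sum s2)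
    · exact (WeightGE.mul_of_apply_zero_of_apply_zero (ih J L) (ih L K) (h.defect_zero J L)
        (h.defect_zero L K) (h.smooth_defect J L) (h.smooth_defect L K)).mono (by omega)
    · rcases le_or_gt (w J + w I) r with hJI | hJI
      · have s3 : ∀ L ∈ Finset.univ, SmoothNear fun u : ι → ℝ => c J I L * (u I * W L u K) :=
          fun L _ => (SmoothNear.const _).mul ((SmoothNear.coord I).mul ((h.smooth L).apply K))
        refine WeightGE.congr (WeightGE.sum (f := fun L u => c J I L * (u I * W L u K))
          (fun L _ => ?_) s3) ?_
        · by_cases hL : w L = w J + w I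
          · refine WeightGE.const_mul (WeightGE.mono (WeightGE.coord_mul
              (h.weight_frame (ih L K)) ((h.smooth L).apply K) I) (by omega)) ?_ _
            exact (SmoothNear.coord I).mul ((h.smooth L).apply K)
          · simpa [hc J I L hJI hL] using WeightGE.zero
        · filter_upwards [h.bracket J I hJI] with u hu
          simp [hu, Finset.mul_sum, mul_left_comm]
      · exact (h.weight_bracket_of_lt hw hJI ih K).mono (by omega)

/-- Two frames with the same structure constants agree up to terms of higher weight. -/
theorem weight_sub (h : EulerFrame w r c W) (h' : EulerFrame w r c W') (hw : ∀ I, w I ≤ r)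
    (hc : ∀ J I L, w J + w I ≤ r → w L ≠ w J + w I → c J I L = 0) (k : ℕ) :
    ∀ J K, WeightGE w (k + 1) (fun u => defect W J K u - defect W' J K u)
      (1 + (w K : ℤ) - w J) := by
  have sD : ∀ J K, SmoothNear fun u => defect W J K u - defect W' J K u :=
    fun J K => (h.smooth_defect J K).sub (h'.smooth_defect J K)
  have D0 : ∀ J K, defect W J K 0 - defect W' J K 0 = 0 := fun J K => by
    rw [h.defect_zero, h'.defect_zero, sub_zero]
  induction k with
  | zero => exact fun J K => ⟨fun _ => D0 J K, fun _ => trivial⟩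
  | succ k ih =>
    intro J K
    have s1 : ∀ L ∈ Finset.univ, SmoothNear fun u =>
        defect W J L u * (defect W L K u - defect W' L K u) :=
      fun L _ => (h.smooth_defect J L).mul (sD L K)
    have s2 : ∀ L ∈ Finset.univ, SmoothNear fun u =>
        (defect W J L u - defect W' J L u) * defect W' L K u :=
      fun L _ => (sD J L).mul (h'.smooth_defect L K)
    have s3 : ∀ I ∈ Finset.univ, SmoothNear fun u : ι → ℝ =>
        u I * VectorField.lieBracket ℝ (W J) (W I) u K -
          u I * VectorField.lieBracket ℝ (W' J) (W' I) u K :=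
      fun I _ => ((SmoothNear.coord I).mul ((h.smooth_bracket J I).apply K)).sub
        ((SmoothNear.coord I).mul ((h'.smooth_bracket J I).apply K))
    -- The quadratic terms are split as `D D - D' D' = D (D - D') + (D - D') D'`, so that each
    -- product contains one factor with the improved weight.
    refine WeightGE.of_euler_add one_pos (sD J K) (WeightGE.congr (f := fun u =>
      -((∑ L, defect W J L u * (defect W L K u - defect W' L K u)) +
        ∑ L, (defect W J L u - defect W' J L u) * defect W' L K u) -
      ∑ I, (u I * VectorField.lieBracket ℝ (W J) (W I) u K -
          u I * VectorField.lieBracket ℝ (W' J) (W' I) u K)) ?_ ?_)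
    · refine WeightGE.sub (WeightGE.neg (WeightGE.add (WeightGE.sum (fun L _ => ?_) s1)
        (WeightGE.sum (fun L _ => ?_) s2) (SmoothNear.sum s1) (SmoothNear.sum s2))
        ((SmoothNear.sum s1).add (SmoothNear.sum s2)))
        (WeightGE.sum (fun I _ => ?_) s3) ((SmoothNear.sum s1).add (SmoothNear.sum s2)).neg
        (SmoothNear.sum s3)
      · exact (WeightGE.mul_of_apply_zero_of_apply_zero (h.weight_defect hw hc k J L) (ih L K)
          (h.defect_zero J L) (D0 L K) (h.smooth_defect J L) (sD L K)).mono (by omega)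
      · exact (WeightGE.mul_of_apply_zero_of_apply_zero (ih J L) (h'.weight_defect hw hc k L K)
          (D0 J L) (h'.defect_zero L K) (sD J L) (h'.smooth_defect L K)).mono (by omega)
      · rcases le_or_gt (w J + w I) r with hJI | hJI
        · have s4 : ∀ L, SmoothNear fun u : ι → ℝ =>
              u I * (defect W L K u - defect W' L K u) :=
            fun L => (SmoothNear.coord I).mul (sD L K)
          refine WeightGE.congr (WeightGE.sum (T := Finset.univ) (f := fun L u => c J I L *
            (u I * (defect W L K u - defect W' L K u))) (fun L _ => ?_)
            fun L _ => (SmoothNear.const _).mul (s4 L)) ?_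
          · by_cases hL : w L = w J + w I
            · exact WeightGE.const_mul (WeightGE.mono (WeightGE.coord_mul (ih L K) (sD L K) I)
                (by omega)) (s4 L) _
            · simpa [hc J I L hJI hL] using WeightGE.zero
          · filter_upwards [h.bracket J I hJI, h'.bracket J I hJI] with u hu hu'
            rw [hu, hu', ← mul_sub]
            simp only [defect, sub_sub_sub_cancel_right, Finset.sum_apply, Pi.smul_apply,
              smul_eq_mul, ← Finset.sum_sub_distrib, ← mul_sub, Finset.mul_sum]
            exact Finset.sum_congr rfl fun L _ => mul_left_comm _ _ _
        · exact (h.weight_bracket_of_lt hw hJI (h.weight_defect hw hc k) K).sub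
            (h'.weight_bracket_of_lt hw hJI (h'.weight_defect hw hc k) K)
            ((SmoothNear.coord I).mul ((h.smooth_bracket J I).apply K))
            ((SmoothNear.coord I).mul ((h'.smooth_bracket J I).apply K))
    · filter_upwards [h.euler_defect J K, h'.euler_defect J K,
        (h.smooth_defect J K).differentiableAt, (h'.smooth_defect J K).differentiableAt]
        with u hu hu' d d'
      have e : fderiv ℝ (fun u => defect W J K u - defect W' J K u) u u =
          fderiv ℝ (defect W J K) u u - fderiv ℝ (defect W' J K) u u := by
        rw [fderiv_fun_sub d d']; rfl
      have e' : ∑ L, defect W J L u * (defect W L K u - defect W' L K u) +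
          ∑ L, (defect W J L u - defect W' J L u) * defect W' L K u =
          (∑ L, defect W J L u * defect W L K u) - ∑ L, defect W' J L u * defect W' L K u := by
        rw [← Finset.sum_add_distrib, ← Finset.sum_sub_distrib]
        exact Finset.sum_congr rfl fun L _ => by ring
      rw [e, e', Finset.sum_sub_distrib]
      linarith

end EulerFrame

end Frames

/-! ### Superposition operators on spaces of continuous maps. -/

section Superposition

universe u

variable {T : Type*} [TopologicalSpace T] [CompactSpace T]

variable {G E F : Type*} [NormedAddCommGroup G] [NormedSpace ℝ G] [NormedAddCommGroup E]
  [NormedSpace ℝ E] [NormedAddCommGroup F] [NormedSpace ℝ F]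

/-- The pointwise extension of a bounded bilinear map to continuous functions. -/
def pointwiseLin (b : G →L[ℝ] E →L[ℝ] F) : C(T, G) →ₗ[ℝ] C(T, E) →ₗ[ℝ] C(T, F) :=
  LinearMap.mk₂ ℝ
    (fun A ψ => ⟨fun t => b (A t) (ψ t), (b.continuous.comp A.continuous).clm_apply ψ.continuous⟩)
    (fun A A' ψ => by ext t; simp) (fun a A ψ => by ext t; simp)
    (fun A ψ ψ' => by ext t; simp) (fun a A ψ => by ext t; simp)

theorem norm_pointwiseLin_le (b : G →L[ℝ] E →L[ℝ] F) (A : C(T, G)) (ψ : C(T, E)) :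
    ‖pointwiseLin b A ψ‖ ≤ ‖b‖ * ‖A‖ * ‖ψ‖ := by
  rw [ContinuousMap.norm_le _ (by positivity)]
  intro t
  refine (b.le_opNorm₂ (A t) (ψ t)).trans ?_
  gcongr
  · exact A.norm_coe_le_norm t
  · exact ψ.norm_coe_le_norm t

/-- The pointwise extension of a bounded bilinear map to continuous functions, as a bounded
bilinear map. -/
def pointwise (b : G →L[ℝ] E →L[ℝ] F) : C(T, G) →L[ℝ] C(T, E) →L[ℝ] C(T, F) :=
  LinearMap.mkContinuous₂ (pointwiseLin b) ‖b‖ (norm_pointwiseLin_le b)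

theorem pointwise_apply (b : G →L[ℝ] E →L[ℝ] F) (A : C(T, G)) (ψ : C(T, E)) (t : T) :
    pointwise b A ψ t = b (A t) (ψ t) := rfl

/-- Continuity of `φ ↦ g' ∘ φ` in the sup norm controls `g'` uniformly along the segments from `φ t`
to `φ t + ψ t`; the mean value inequality then bounds the remainder uniformly in `t`. -/
theorem hasFDerivAt_superposition (b : G →L[ℝ] E →L[ℝ] F) (g : C(E, F)) (g' : C(E, G))
    (hg : ∀ x, HasFDerivAt g (b (g' x)) x) (φ : C(T, E)) :
    HasFDerivAt (fun φ : C(T, E) => g.comp φ) (pointwise b (g'.comp φ)) φ := by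
  rw [hasFDerivAt_iff_isLittleO_nhds_zero, Asymptotics.isLittleO_iff]
  intro ε hε
  have hc : Continuous fun φ : C(T, E) => g'.comp φ := ContinuousMap.continuous_postcomp g'
  obtain ⟨δ, hδ, hball⟩ := (Metric.continuousAt_iff (f := fun φ : C(T, E) => g'.comp φ)).1
    (hc.continuousAt (x := φ)) (ε / (‖b‖ + 1)) (by positivity)
  filter_upwards [Metric.ball_mem_nhds 0 hδ] with ψ hψ
  rw [mem_ball_zero_iff] at hψ
  rw [ContinuousMap.norm_le _ (by positivity)]
  intro t
  have hseg : ∀ x ∈ segment ℝ (φ t) (φ t + ψ t), ‖b (g' x) - b (g' (φ t))‖ ≤ ε := by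
    intro x hx
    rw [segment_eq_image'] at hx
    obtain ⟨s, hs, rfl⟩ := hx
    have h1 : dist (φ + s • ψ) φ < δ := by
      rw [dist_eq_norm, add_sub_cancel_left, norm_smul, Real.norm_eq_abs, abs_of_nonneg hs.1]
      exact (mul_le_of_le_one_left (norm_nonneg _) hs.2).trans_lt hψ
    have h2 := (hball h1).le
    rw [dist_eq_norm, ContinuousMap.norm_le _ (by positivity)] at h2
    rw [← map_sub]
    refine (b.le_opNorm _).trans ?_
    have h4 : ‖g' (φ t + s • (φ t + ψ t - φ t)) - g' (φ t)‖ ≤ ε / (‖b‖ + 1) := by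
      simpa using h2 t
    calc ‖b‖ * _ ≤ (‖b‖ + 1) * (ε / (‖b‖ + 1)) := by gcongr; linarith
      _ = ε := by field_simp
  have h3 := (convex_segment (𝕜 := ℝ) (φ t) (φ t + ψ t)).norm_image_sub_le_of_norm_hasFDerivWithin_le'
    (fun x _ => (hg x).hasFDerivWithinAt) hseg (left_mem_segment ℝ _ _) (right_mem_segment ℝ _ _)
  rw [add_sub_cancel_left] at h3
  exact h3.trans (mul_le_mul_of_nonneg_left (ψ.norm_coe_le_norm t) hε.le)

/-- The derivative is pointwise multiplication by `g' ∘ φ`, itself a superposition with values in `E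
→L[ℝ] F`. Hence the target varies in the induction. -/
theorem contDiff_superposition_nat {E : Type u} [NormedAddCommGroup E] [NormedSpace ℝ E] (m : ℕ) :
    ∀ {F : Type u} [NormedAddCommGroup F] [NormedSpace ℝ F] (g : C(E, F)), ContDiff ℝ m g →
      ContDiff ℝ m fun φ : C(T, E) => g.comp φ := by
  induction m with
  | zero =>
    intro F _ _ g _
    exact contDiff_zero.2 (ContinuousMap.continuous_postcomp g)
  | succ m ih =>
    intro F _ _ g hg
    obtain ⟨g', hg', hd⟩ := contDiff_succ_iff_hasFDerivAt.1 hg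
    have h1 := ih ⟨g', hg'.continuous⟩ hg'
    exact contDiff_succ_iff_hasFDerivAt.2 ⟨_, (pointwise (T := T)
      (ContinuousLinearMap.id ℝ (E →L[ℝ] F))).contDiff.comp h1,
      hasFDerivAt_superposition (ContinuousLinearMap.id ℝ (E →L[ℝ] F)) g ⟨g', hg'.continuous⟩ hd⟩

/-- Composition with a smooth map is smooth on spaces of continuous maps. -/
theorem contDiff_superposition {E F : Type u} [NormedAddCommGroup E] [NormedSpace ℝ E]
    [NormedAddCommGroup F] [NormedSpace ℝ F] (g : C(E, F)) (hg : ContDiff ℝ ∞ g) :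
    ContDiff ℝ ∞ fun φ : C(T, E) => g.comp φ :=
  contDiff_infty.2 fun m => contDiff_superposition_nat m g (contDiff_infty.1 hg m)

end Superposition

/-! ### Volterra operators on continuous paths. -/

section Volterra

set_option linter.unusedSectionVars false

variable {G E : Type*} [NormedAddCommGroup G] [NormedSpace ℝ G] [NormedAddCommGroup E]
  [NormedSpace ℝ E]

/-- The extension of a path on `[0, 1]` by constants. -/
def extendPath (φ : C(Icc (0 : ℝ) 1, E)) : C(ℝ, E) := φ.IccExtend zero_le_one

theorem extendPath_apply (φ : C(Icc (0 : ℝ) 1, E)) {t : ℝ} (ht : t ∈ Icc (0 : ℝ) 1) :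
    extendPath φ t = φ ⟨t, ht⟩ :=
  IccExtend_of_mem zero_le_one φ ht

theorem norm_extendPath_le (φ : C(Icc (0 : ℝ) 1, E)) (t : ℝ) : ‖extendPath φ t‖ ≤ ‖φ‖ :=
  φ.norm_coe_le_norm _

/-- The primitive vanishing at `0`, as a bounded operator on continuous paths. -/
def primitiveCLM : C(Icc (0 : ℝ) 1, E) →L[ℝ] C(Icc (0 : ℝ) 1, E) :=
  LinearMap.mkContinuous
    { toFun := fun φ => ⟨fun t => ∫ s in (0 : ℝ)..t, extendPath φ s, by
        exact (intervalIntegral.continuous_primitive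
          (fun a b => (extendPath φ).continuous.intervalIntegrable a b) 0).comp
            continuous_subtype_val⟩
      map_add' := fun φ ψ => by
        ext t
        exact intervalIntegral.integral_add ((extendPath φ).continuous.intervalIntegrable _ _)
          ((extendPath ψ).continuous.intervalIntegrable _ _)
      map_smul' := fun a φ => by
        ext t
        exact intervalIntegral.integral_smul a _ } 1 fun φ => by
    rw [one_mul, ContinuousMap.norm_le _ (norm_nonneg _)]
    intro t
    refine (intervalIntegral.norm_integral_le_of_norm_le_const (C := ‖φ‖)
      fun s _ => norm_extendPath_le φ s).trans ?_
    rw [sub_zero, abs_of_nonneg t.2.1]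
    exact mul_le_of_le_one_right (norm_nonneg _) t.2.2

theorem primitiveCLM_apply (φ : C(Icc (0 : ℝ) 1, E)) (t : Icc (0 : ℝ) 1) :
    primitiveCLM φ t = ∫ s in (0 : ℝ)..t, extendPath φ s := rfl

/-- The Volterra operator `ψ ↦ ∫₀ᵗ b(A(s), ψ(s)) ds`. -/
def volterra (b : G →L[ℝ] E →L[ℝ] E) (A : C(Icc (0 : ℝ) 1, G)) : C(Icc (0 : ℝ) 1, E) →L[ℝ] C(Icc (0 : ℝ) 1, E) :=
  primitiveCLM.comp (pointwise b A)

/-- Iterated integration of the constant bound produces the factor `t ^ m / m!`. -/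
theorem norm_volterra_pow_apply_le (b : G →L[ℝ] E →L[ℝ] E) (A : C(Icc (0 : ℝ) 1, G)) (ψ : C(Icc (0 : ℝ) 1, E))
    (m : ℕ) (t : Icc (0 : ℝ) 1) :
    ‖(volterra b A ^ m) ψ t‖ ≤ (‖b‖ * ‖A‖) ^ m * (t : ℝ) ^ m / m.factorial * ‖ψ‖ := by
  induction m generalizing t with
  | zero => simpa using ψ.norm_coe_le_norm t
  | succ m ih =>
    rw [pow_succ']
    change ‖primitiveCLM (pointwise b A ((volterra b A ^ m) ψ)) t‖ ≤ _
    rw [primitiveCLM_apply]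
    refine (intervalIntegral.norm_integral_le_of_norm_le (g := fun s : ℝ =>
      ((‖b‖ * ‖A‖) ^ (m + 1) / m.factorial * ‖ψ‖) * s ^ m) t.2.1 ?_ ?_).trans ?_
    · refine Eventually.of_forall fun s hs => ?_
      have hs' : s ∈ Icc (0 : ℝ) 1 := ⟨hs.1.le, hs.2.trans t.2.2⟩
      rw [extendPath_apply _ hs', pointwise_apply]
      refine (b.le_opNorm₂ _ _).trans ((mul_le_mul (mul_le_mul_of_nonneg_left
        (A.norm_coe_le_norm _) (norm_nonneg b)) (ih ⟨s, hs'⟩)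
        (norm_nonneg _) (by positivity)).trans_eq ?_)
      simp only
      ring
    · exact (continuous_const.mul (continuous_pow m)).intervalIntegrable _ _
    · rw [intervalIntegral.integral_const_mul, integral_pow, Nat.factorial_succ]
      apply le_of_eq
      push_cast
      have : (m.factorial : ℝ) ≠ 0 := by positivity
      have : (m : ℝ) + 1 ≠ 0 := by positivity
      field_simp
      simp

/-- By the factorial bound some power `V ^ m` has norm less than one, so `1 - V ^ m` is invertible;
`1 - V` is a factor of it, commuting with the cofactor. -/
theorem isUnit_one_sub_volterra [CompleteSpace E] (b : G →L[ℝ] E →L[ℝ] E) (A : C(Icc (0 : ℝ) 1, G)) :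
    IsUnit (1 - volterra b A) := by
  obtain ⟨m, hm⟩ := ((FloorSemiring.tendsto_pow_div_factorial_atTop (‖b‖ * ‖A‖)).eventually
    (gt_mem_nhds one_pos)).exists
  have h1 : ‖volterra b A ^ m‖ < 1 := by
    refine (ContinuousLinearMap.opNorm_le_bound _ (by positivity) fun ψ => ?_).trans_lt hm
    rw [ContinuousMap.norm_le _ (by positivity)]
    intro t
    refine (norm_volterra_pow_apply_le b A ψ m t).trans ?_
    have : (t : ℝ) ^ m ≤ 1 := pow_le_one₀ t.2.1 t.2.2
    gcongr
    exact mul_le_of_le_one_right (by positivity) this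
  have h2 := isUnit_one_sub_of_norm_lt_one
    (R := C(Icc (0 : ℝ) 1, E) →L[ℝ] C(Icc (0 : ℝ) 1, E)) (x := volterra b A ^ m) h1
  rw [← mul_neg_geom_sum] at h2
  refine ((Commute.isUnit_mul_iff ?_).1 h2).1
  rw [commute_iff_eq, mul_neg_geom_sum, geom_sum_mul_neg]

end Volterra

/-! ### Implicit functions in Banach spaces. -/

/-- The graph map `(x, y) ↦ (x, Φ(x, y))` has an invertible derivative if `Φ` has one in `y`. -/
theorem exists_equiv_hasFDerivAt_graph {P Q R : Type*} [NormedAddCommGroup P] [NormedSpace ℝ P]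
    [NormedAddCommGroup Q] [NormedSpace ℝ Q] [NormedAddCommGroup R] [NormedSpace ℝ R]
    {Φ : P × Q → R} {a : P × Q} (hΦ : DifferentiableAt ℝ Φ a) (e : Q ≃L[ℝ] R)
    (he : HasFDerivAt (fun y => Φ (a.1, y)) (e : Q →L[ℝ] R) a.2) :
    ∃ L : (P × Q) ≃L[ℝ] P × R,
      HasFDerivAt (fun z : P × Q => (z.1, Φ z)) (L : P × Q →L[ℝ] P × R) a := by
  have hd := hΦ.hasFDerivAt
  have hr : (fderiv ℝ Φ a).comp (ContinuousLinearMap.inr ℝ P Q) = e := by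
    refine HasFDerivAt.unique ?_ he
    exact hd.comp a.2 ((hasFDerivAt_const a.1 a.2).prodMk (hasFDerivAt_id a.2))
  -- The derivative is block triangular with diagonal blocks `1` and `e`.
  refine ⟨(ContinuousLinearEquiv.refl ℝ P).skewProd e
    ((fderiv ℝ Φ a).comp (ContinuousLinearMap.inl ℝ P Q)), ?_⟩
  have h1 : HasFDerivAt (fun z : P × Q => (z.1, Φ z))
      ((ContinuousLinearMap.fst ℝ P Q).prod (fderiv ℝ Φ a)) a := hasFDerivAt_fst.prodMk hd
  convert h1 using 1
  refine ContinuousLinearMap.ext fun z => Prod.ext rfl ?_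
  change e z.2 + fderiv ℝ Φ a (z.1, 0) = fderiv ℝ Φ a z
  have h2 : e z.2 = fderiv ℝ Φ a (0, z.2) := congrArg (fun M : Q →L[ℝ] R => M z.2) hr.symm
  rw [h2, ← map_add, Prod.mk_add_mk, zero_add, add_zero]

/-- The implicit function theorem for smooth maps between Banach spaces. -/
theorem exists_implicit {P Q R : Type*} [NormedAddCommGroup P] [NormedSpace ℝ P] [CompleteSpace P]
    [NormedAddCommGroup Q] [NormedSpace ℝ Q] [CompleteSpace Q] [NormedAddCommGroup R]
    [NormedSpace ℝ R] {Φ : P × Q → R} {a : P × Q} (hΦ : ContDiffAt ℝ ∞ Φ a) (h0 : Φ a = 0)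
    (e : Q ≃L[ℝ] R) (he : HasFDerivAt (fun y => Φ (a.1, y)) (e : Q →L[ℝ] R) a.2) :
    ∃ S : P → Q, ContDiffAt ℝ ∞ S a.1 ∧ S a.1 = a.2 ∧ ∀ᶠ x in 𝓝 a.1, Φ (x, S x) = 0 := by
  obtain ⟨L, hΨ'⟩ := exists_equiv_hasFDerivAt_graph (hΦ.differentiableAt (by simp)) e he
  let Ψ : P × Q → P × R := fun z => (z.1, Φ z)
  have hΨ : ContDiffAt ℝ ∞ Ψ a := contDiffAt_fst.prodMk hΦ
  have hn : (∞ : WithTop ℕ∞) ≠ 0 := by simp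
  let g := hΨ.localInverse hΨ' hn
  have hg : ContDiffAt ℝ ∞ g (Ψ a) := hΨ.to_localInverse hΨ' hn
  have hga : g (Ψ a) = a := hΨ.localInverse_apply_image hΨ' hn
  have hgr : ∀ᶠ y in 𝓝 (Ψ a), Ψ (g y) = y :=
    (hΨ.hasStrictFDerivAt' hΨ' hn).eventually_right_inverse
  have hΨa : Ψ a = (a.1, 0) := by simp [Ψ, h0]
  rw [hΨa] at hg hga hgr
  refine ⟨fun x => (g (x, 0)).2, ?_, by simp [hga], ?_⟩
  · exact contDiffAt_snd.comp a.1
      (ContDiffAt.comp (f := fun x : P => (x, (0 : R))) a.1 hg (contDiffAt_id.prodMk contDiffAt_const))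
  · have hc : ContinuousAt (fun x : P => (x, (0 : R))) a.1 := by fun_prop
    filter_upwards [hc.eventually hgr] with x hx
    have h1 : (g (x, 0)).1 = x := congrArg Prod.fst hx
    have h2 : Φ (g (x, 0)) = 0 := congrArg Prod.snd hx
    rwa [show (x, (g (x, 0)).2) = g (x, 0) from Prod.ext h1.symm rfl]

universe u

/-! ### Smooth dependence of solutions on initial point and parameters. -/

section Flow

variable {κ : Type*} [Fintype κ]

/-- The linearization of the integral equation of a flow in the unknown path. -/
theorem hasFDerivAt_integral_equation {G E : Type*} [NormedAddCommGroup G] [NormedSpace ℝ G]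
    [NormedAddCommGroup E] [NormedSpace ℝ E] (b : G →L[ℝ] E →L[ℝ] E) {X : κ → C(E, E)}
    {X' : κ → C(E, G)} (hX : ∀ k x, HasFDerivAt (X k) (b (X' k x)) x) (a : κ → ℝ)
    (η : C(Icc (0 : ℝ) 1, E)) (φ : C(Icc (0 : ℝ) 1, E)) :
    HasFDerivAt (fun φ : C(Icc (0 : ℝ) 1, E) =>
        φ - η - primitiveCLM (∑ k, a k • (X k).comp φ))
      (1 - volterra b (∑ k, a k • (X' k).comp φ)) φ := by
  have h1 : HasFDerivAt (fun φ : C(Icc (0 : ℝ) 1, E) => ∑ k, a k • (X k).comp φ)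
      (∑ k, a k • pointwise b ((X' k).comp φ)) φ :=
    HasFDerivAt.fun_sum fun k _ =>
      (hasFDerivAt_superposition b (X k) (X' k) (hX k) φ).const_smul (a k)
  have h2 := ((hasFDerivAt_id φ).sub_const η).sub
    ((primitiveCLM (E := E)).hasFDerivAt.comp φ h1)
  have h3 : volterra b (∑ k, a k • (X' k).comp φ) =
      (primitiveCLM (E := E)).comp (∑ k, a k • pointwise b ((X' k).comp φ)) := by
    simp [volterra, map_sum]
  rw [h3]
  exact h2

/-- Solutions of `φ' = ∑ u_k X_k(φ)` on `[0, 1]` depend smoothly on the initial point and on the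
parameters `u`. -/
theorem exists_smooth_solution {E : Type u} [NormedAddCommGroup E] [NormedSpace ℝ E]
    [CompleteSpace E] {X : κ → C(E, E)} (hX : ∀ k, ContDiff ℝ ∞ (X k)) {η : E} {a : κ → ℝ}
    {φ : C(Icc (0 : ℝ) 1, E)}
    (hφ : φ - ContinuousMap.const _ η - primitiveCLM (∑ k, a k • (X k).comp φ) = 0) :
    ∃ S : E × (κ → ℝ) → C(Icc (0 : ℝ) 1, E), ContDiffAt ℝ ∞ S (η, a) ∧ S (η, a) = φ ∧
      ∀ᶠ q in 𝓝 (η, a), S q - ContinuousMap.const _ q.1 -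
        primitiveCLM (∑ k, q.2 k • (X k).comp (S q)) = 0 := by
  -- Zeros of `Φ` are the solutions of the integral equation; its partial derivative in the path is
  -- `1` minus a Volterra operator, hence invertible.
  let Φ : (E × (κ → ℝ)) × C(Icc (0 : ℝ) 1, E) → C(Icc (0 : ℝ) 1, E) := fun z =>
    z.2 - ContinuousMap.const _ z.1.1 - primitiveCLM (∑ k, z.1.2 k • (X k).comp z.2)
  have hconst : ContDiff ℝ ∞ fun x : E => ContinuousMap.const (Icc (0 : ℝ) 1) x := by
    let l : E →ₗ[ℝ] C(Icc (0 : ℝ) 1, E) :=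
      { toFun := ContinuousMap.const _, map_add' := fun _ _ => rfl, map_smul' := fun _ _ => rfl }
    exact (l.mkContinuous 1 fun x => by
      rw [ContinuousMap.norm_le _ (by positivity)]
      intro t
      exact (one_mul ‖x‖).ge).contDiff
  have hΦ : ContDiff ℝ ∞ Φ := by
    refine (contDiff_snd.sub (hconst.comp (contDiff_fst.comp contDiff_fst))).sub
      ((primitiveCLM (E := E)).contDiff.comp (ContDiff.sum fun k _ => ?_))
    exact ((contDiff_apply ℝ ℝ k).comp (contDiff_snd.comp contDiff_fst)).smul
      ((contDiff_superposition (X k) (hX k)).comp contDiff_snd)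
  have hX' : ∀ k, Continuous (fderiv ℝ (X k)) := fun k => (hX k).continuous_fderiv (by simp)
  have hd : ∀ k x, HasFDerivAt (X k)
      (ContinuousLinearMap.id ℝ (E →L[ℝ] E) ((⟨fderiv ℝ (X k), hX' k⟩ : C(E, E →L[ℝ] E)) x)) x :=
    fun k x => ((hX k).differentiable (by simp) x).hasFDerivAt
  have hD := hasFDerivAt_integral_equation _ hd a (ContinuousMap.const _ η) φ
  have hu := isUnit_one_sub_volterra (ContinuousLinearMap.id ℝ (E →L[ℝ] E))
    (∑ k, a k • (⟨fderiv ℝ (X k), hX' k⟩ : C(E, E →L[ℝ] E)).comp φ)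
  obtain ⟨v, hv⟩ := hu
  rw [← hv] at hD
  exact exists_implicit (Φ := Φ) (a := ((η, a), φ)) hΦ.contDiffAt hφ
    (ContinuousLinearEquiv.unitsEquiv ℝ _ v) hD

end Flow

/-! ### The exponential: uniqueness and smoothness. -/

section IsExp

variable {E : Type u} [NormedAddCommGroup E] [NormedSpace ℝ E] {Ω Ω' : Set E} {Z Z' : E → E}
  {x y y' : E}

theorem IsExp.mono (h : IsExp Ω Z x y) (hΩ : Ω ⊆ Ω') : IsExp Ω' Z x y := by
  obtain ⟨φ, h0, h1, h2⟩ := h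
  exact ⟨φ, h0, h1, fun t ht => ⟨hΩ (h2 t ht).1, (h2 t ht).2⟩⟩

theorem IsExp.congr (h : IsExp Ω Z x y) (hZ : EqOn Z Z' Ω) : IsExp Ω Z' x y := by
  obtain ⟨φ, h0, h1, h2⟩ := h
  exact ⟨φ, h0, h1, fun t ht => ⟨(h2 t ht).1, hZ (h2 t ht).1 ▸ (h2 t ht).2⟩⟩

theorem IsExp.exists_isCompact (h : IsExp Ω Z x y) :
    ∃ K, IsCompact K ∧ K ⊆ Ω ∧ IsExp K Z x y := by
  obtain ⟨φ, h0, h1, h2⟩ := h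
  refine ⟨φ '' Icc 0 1, isCompact_Icc.image_of_continuousOn fun t ht =>
    (h2 t ht).2.continuousWithinAt, ?_, φ, h0, h1, fun t ht => ⟨mem_image_of_mem φ ht, (h2 t ht).2⟩⟩
  rintro _ ⟨t, ht, rfl⟩
  exact (h2 t ht).1

theorem IsExp.fst_mem (h : IsExp Ω Z x y) : x ∈ Ω := by
  obtain ⟨φ, rfl, _, h2⟩ := h
  exact (h2 0 (by simp)).1

theorem IsExp.snd_mem (h : IsExp Ω Z x y) : y ∈ Ω := by
  obtain ⟨φ, _, rfl, h2⟩ := h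
  exact (h2 1 (by simp)).1

/-- The points `exp(tZ)(x)` form the integral curve. -/
theorem IsExp.exists_curve (h : IsExp Ω Z x y) :
    ∃ φ : ℝ → E, φ 0 = x ∧ φ 1 = y ∧
      (∀ t ∈ Icc (0 : ℝ) 1, HasDerivWithinAt φ (Z (φ t)) (Icc 0 1) t) ∧
      ∀ t ∈ Icc (0 : ℝ) 1, IsExp Ω (fun z => t • Z z) x (φ t) := by
  obtain ⟨φ, h0, h1, h2⟩ := h
  refine ⟨φ, h0, h1, fun t ht => (h2 t ht).2, fun t ht => ⟨fun s => φ (t * s), by simp [h0], by simp,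
    fun s hs => ?_⟩⟩
  have hmaps : MapsTo (fun s => t * s) (Icc (0 : ℝ) 1) (Icc 0 1) := fun s hs =>
    ⟨mul_nonneg ht.1 hs.1, mul_le_one₀ ht.2 hs.1 hs.2⟩
  refine ⟨(h2 _ (hmaps hs)).1, ?_⟩
  have h3 : HasDerivWithinAt (fun s : ℝ => t * s) t (Icc 0 1) s := by
    simpa using ((hasDerivAt_id s).const_mul t).hasDerivWithinAt
  exact (h2 _ (hmaps hs)).2.scomp s h3 hmaps

theorem isExp_zero (hx : x ∈ Ω) (hZ : EqOn Z 0 Ω) : IsExp Ω Z x x :=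
  ⟨fun _ => x, rfl, rfl, fun t _ => ⟨hx, by rw [hZ hx]; exact hasDerivWithinAt_const _ _ _⟩⟩

variable [FiniteDimensional ℝ E] {κ : Type*} [Fintype κ]

/-- Smooth fields on an open set agree near a given compact subset with compactly supported smooth
fields on the whole space. -/
theorem exists_cutoff (hΩ : IsOpen Ω) {K : Set E} (hK : IsCompact K) (hKΩ : K ⊆ Ω) :
    ∃ N, IsOpen N ∧ K ⊆ N ∧ N ⊆ Ω ∧ ∀ Z : E → E, ContDiffOn ℝ ∞ Z Ω →
      ∃ Z' : E → E, ContDiff ℝ ∞ Z' ∧ HasCompactSupport Z' ∧ EqOn Z Z' N := by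
  obtain ⟨K₁, hK₁, hKK₁, hK₁Ω⟩ := exists_compact_between hK hΩ hKΩ
  obtain ⟨K₂, hK₂, hK₁₂, hK₂Ω⟩ := exists_compact_between hK₁ hΩ hK₁Ω
  obtain ⟨χ, hχ, -, hsupp, hone⟩ := exists_contMDiff_support_eq_eq_one_iff (n := ⊤)
    (modelWithCornersSelf ℝ E) isOpen_interior hK₁.isClosed hK₁₂
  have hχ' : ContDiff ℝ ∞ χ := hχ.contDiff
  have htsupp : tsupport χ ⊆ K₂ := by
    rw [tsupport, hsupp]
    exact closure_minimal interior_subset hK₂.isClosed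
  have hcomp : HasCompactSupport χ := hK₂.of_isClosed_subset (isClosed_tsupport _) htsupp
  refine ⟨interior K₁, isOpen_interior, hKK₁, interior_subset.trans hK₁Ω, fun Z hZ =>
    ⟨fun z => χ z • Z z, ?_, hcomp.smul_right, fun z hz => ?_⟩⟩
  · rw [contDiff_iff_contDiffAt]
    intro z
    by_cases hz : z ∈ tsupport χ
    · exact hχ'.contDiffAt.smul (hZ.contDiffAt (hΩ.mem_nhds (hK₂Ω (htsupp hz))))
    · have : (fun z => χ z • Z z) =ᶠ[𝓝 z] fun _ => 0 := by
        filter_upwards [(isClosed_tsupport χ).isOpen_compl.mem_nhds hz] with w hw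
        rw [image_eq_zero_of_notMem_tsupport hw, zero_smul]
      exact contDiffAt_const.congr_of_eventuallyEq this
  · simp only [(hone z).1 (interior_subset hz), one_smul]

/-- Near the two compact trajectories the field agrees with a compactly supported, hence globally
Lipschitz one, to which uniqueness for ordinary differential equations applies. -/
theorem IsExp.unique (hΩ : IsOpen Ω) (hZ : ContDiffOn ℝ ∞ Z Ω) (h : IsExp Ω Z x y)
    (h' : IsExp Ω Z x y') : y = y' := by
  obtain ⟨K, hK, hKΩ, hKe⟩ := h.exists_isCompact
  obtain ⟨K', hK', hKΩ', hKe'⟩ := h'.exists_isCompact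
  obtain ⟨N, -, hKN, -, hN⟩ := exists_cutoff hΩ (hK.union hK') (union_subset hKΩ hKΩ')
  obtain ⟨Z', hZ', hZc, hZZ'⟩ := hN Z hZ
  obtain ⟨C, hC⟩ := ContDiff.lipschitzWith_of_hasCompactSupport hZc hZ' (by simp)
  obtain ⟨φ, hφ0, hφ1, hφ⟩ := (hKe.mono (subset_union_left.trans hKN)).congr hZZ'
  obtain ⟨ψ, hψ0, hψ1, hψ⟩ := (hKe'.mono (subset_union_right.trans hKN)).congr hZZ'
  have key : ∀ {φ : ℝ → E}, (∀ t ∈ Icc (0 : ℝ) 1, φ t ∈ N ∧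
      HasDerivWithinAt φ (Z' (φ t)) (Icc 0 1) t) → ContinuousOn φ (Icc 0 1) ∧
      ∀ t ∈ Ico (0 : ℝ) 1, HasDerivWithinAt φ (Z' (φ t)) (Ici t) t := fun {φ} hφ =>
    ⟨fun t ht => (hφ t ht).2.continuousWithinAt, fun t ht =>
      (hφ t (Ico_subset_Icc_self ht)).2.mono_of_mem_nhdsWithin (Icc_mem_nhdsGE_of_mem ht)⟩
  have := ODE_solution_unique (v := fun _ => Z') (fun _ => hC) (key hφ).1 (key hφ).2 (key hψ).1
    (key hψ).2 (hφ0.trans hψ0.symm)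
  rw [← hφ1, ← hψ1]
  exact this (by simp)

theorem exists_path_of_isExp {X : κ → C(E, E)} {a : κ → ℝ}
    (h : IsExp Ω (fun z => ∑ k, a k • X k z) x y) :
    ∃ φ : C(Icc (0 : ℝ) 1, E), φ - ContinuousMap.const _ x -
      primitiveCLM (∑ k, a k • (X k).comp φ) = 0 ∧ φ ⟨1, by simp⟩ = y ∧ ∀ t, φ t ∈ Ω := by
  obtain ⟨φ, h0, h1, h2⟩ := h
  have hc : ContinuousOn φ (Icc 0 1) := fun t ht => (h2 t ht).2.continuousWithinAt
  let ψ : C(Icc (0 : ℝ) 1, E) := ⟨fun t => φ t, hc.domRestrict⟩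
  refine ⟨ψ, ?_, h1, fun t => (h2 t t.2).1⟩
  ext t
  change φ t - x - primitiveCLM (∑ k, a k • (X k).comp ψ) t = 0
  rw [primitiveCLM_apply, intervalIntegral.integral_eq_sub_of_hasDerivAt_of_le t.2.1
    (hc.mono (Icc_subset_Icc_right t.2.2)) _ ((extendPath _).continuous.intervalIntegrable _ _), h0]
  · abel
  · intro s hs
    have hs' : s ∈ Ioo (0 : ℝ) 1 := ⟨hs.1, hs.2.trans_le t.2.2⟩
    rw [extendPath_apply _ (Ioo_subset_Icc_self hs')]
    have h3 := (h2 s (Ioo_subset_Icc_self hs')).2.hasDerivAt (Icc_mem_nhds hs'.1 hs'.2)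
    rw [ContinuousMap.sum_apply]
    exact h3

theorem isExp_of_path {X : κ → C(E, E)} {a : κ → ℝ} {φ : C(Icc (0 : ℝ) 1, E)}
    (h : φ - ContinuousMap.const _ x - primitiveCLM (∑ k, a k • (X k).comp φ) = 0)
    (hΩ : ∀ t, φ t ∈ Ω) :
    IsExp Ω (fun z => ∑ k, a k • X k z) x (φ ⟨1, by simp⟩) := by
  have h1 : ∀ t : Icc (0 : ℝ) 1,
      φ t = x + ∫ s in (0 : ℝ)..t, extendPath (∑ k, a k • (X k).comp φ) s := by
    intro t
    have := congrArg (fun f : C(Icc (0 : ℝ) 1, E) => f t) h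
    change φ t - x - primitiveCLM (∑ k, a k • (X k).comp φ) t = 0 at this
    rw [primitiveCLM_apply] at this
    rw [← sub_eq_zero, ← sub_sub]
    exact this
  refine ⟨fun t => x + ∫ s in (0 : ℝ)..t, extendPath (∑ k, a k • (X k).comp φ) s, by simp,
    (h1 ⟨1, by simp⟩).symm, fun t ht => ?_⟩
  have ht' := h1 ⟨t, ht⟩
  simp only at ht' ⊢
  rw [← ht']
  refine ⟨hΩ _, ?_⟩
  have h2 := ((extendPath (∑ k, a k • (X k).comp φ)).continuous.integral_hasStrictDerivAt 0
    t).hasDerivAt.const_add x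
  rw [extendPath_apply _ ht] at h2
  simpa [ContinuousMap.sum_apply] using h2.hasDerivWithinAt

/-- The exponential of `∑ u_k X_k` is defined on an open set of initial points and parameters, and
is smooth there. -/
theorem IsExp.exists_contDiffAt (hΩ : IsOpen Ω) {X : κ → E → E}
    (hX : ∀ k, ContDiffOn ℝ ∞ (X k) Ω) {a : κ → ℝ} (h : IsExp Ω (fun z => ∑ k, a k • X k z) x y) :
    ∃ S : E × (κ → ℝ) → E, ContDiffAt ℝ ∞ S (x, a) ∧
      ∀ᶠ q in 𝓝 (x, a), IsExp Ω (fun z => ∑ k, q.2 k • X k z) q.1 (S q) := by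
  obtain ⟨K, hK, hKΩ, hKe⟩ := h.exists_isCompact
  obtain ⟨N, hNo, hKN, hNΩ, hN⟩ := exists_cutoff hΩ hK hKΩ
  choose X' hX' _ hXX' using fun k => hN (X k) (hX k)
  let Xc : κ → C(E, E) := fun k => ⟨X' k, (hX' k).continuous⟩
  obtain ⟨φ, hφ, -, hφN⟩ := exists_path_of_isExp (X := Xc) ((hKe.mono hKN).congr
    fun z hz => Finset.sum_congr rfl fun k _ => by rw [hXX' k hz]; rfl)
  obtain ⟨S, hS, hS0, hSe⟩ := exists_smooth_solution (X := Xc) hX' hφ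
  refine ⟨fun q => S q ⟨1, by simp⟩,
    ((ContinuousMap.evalCLM (M := E) ℝ (⟨1, by simp⟩ : Icc (0 : ℝ) 1)).contDiff.contDiffAt).comp
      (x, a) hS, ?_⟩
  -- Paths uniformly close to one inside `N` stay in `N`, where the cut-off fields equal the
  -- original ones.
  have hopen : IsOpen {ψ : C(Icc (0 : ℝ) 1, E) | MapsTo ψ univ N} :=
    ContinuousMap.isOpen_setOfPred_mapsTo isCompact_univ hNo
  have hev := hS.continuousAt.eventually (hopen.mem_nhds (by rw [hS0]; exact fun t _ => hφN t))
  filter_upwards [hSe, hev] with q h1 h2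
  refine ((isExp_of_path h1 fun t => h2 (mem_univ t)).congr fun z hz => ?_).mono hNΩ
  exact Finset.sum_congr rfl fun k _ => by rw [hXX' k hz]; rfl

end IsExp

/-! ### Canonical coordinates and the Euler identity. -/

section Canonical

set_option linter.unusedSectionVars false

variable {E : Type u} [NormedAddCommGroup E] [NormedSpace ℝ E] [FiniteDimensional ℝ E]
  {Ω : Set E} {n : ℕ} {X : Fin (n + 1) → E → E} {B : Finset (MultiIndex n)} {η ξ : E} {v : B → ℝ}

/-- Uniqueness of trajectories makes the choice in `expPoint` immaterial. -/
theorem IsExp.canonicalMap_eq (hΩ : IsOpen Ω) (hX : ∀ i, ContDiffOn ℝ ∞ (X i) Ω)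
    (h : IsExp Ω (comboField X B v) η ξ) : canonicalMap Ω X B η v = ξ := by
  have hex : ∃ y, IsExp Ω (comboField X B v) η y := ⟨ξ, h⟩
  have hsm : ContDiffOn ℝ ∞ (comboField X B v) Ω :=
    ContDiffOn.sum fun I _ => (contDiffOn_comm hΩ hX I.1).const_smul (v I)
  rw [canonicalMap, expPoint, dif_pos hex]
  exact hex.choose_spec.unique hΩ hsm h

theorem isExp_zero_combo (hη : η ∈ Ω) : IsExp Ω (comboField X B 0) η η :=
  isExp_zero hη fun z _ => by simp [comboField]

theorem canonicalMap_zero (hΩ : IsOpen Ω) (hX : ∀ i, ContDiffOn ℝ ∞ (X i) Ω) (hη : η ∈ Ω) :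
    canonicalMap Ω X B η 0 = η :=
  (isExp_zero_combo hη).canonicalMap_eq hΩ hX

theorem IsExp.eventually (hΩ : IsOpen Ω) (hX : ∀ i, ContDiffOn ℝ ∞ (X i) Ω)
    (h : IsExp Ω (comboField X B v) η ξ) :
    ∀ᶠ q : E × (B → ℝ) in 𝓝 (η, v),
      IsExp Ω (comboField X B q.2) q.1 (canonicalMap Ω X B q.1 q.2) := by
  obtain ⟨S, -, hS⟩ := IsExp.exists_contDiffAt hΩ (fun I : B => contDiffOn_comm hΩ hX I.1) h
  filter_upwards [hS] with q hq
  rw [hq.canonicalMap_eq hΩ hX]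
  exact hq

theorem IsExp.contDiffAt_canonicalMap (hΩ : IsOpen Ω) (hX : ∀ i, ContDiffOn ℝ ∞ (X i) Ω)
    (h : IsExp Ω (comboField X B v) η ξ) :
    ContDiffAt ℝ ∞ (fun q : E × (B → ℝ) => canonicalMap Ω X B q.1 q.2) (η, v) := by
  obtain ⟨S, hS, hSe⟩ := IsExp.exists_contDiffAt hΩ (fun I : B => contDiffOn_comm hΩ hX I.1) h
  refine hS.congr_of_eventuallyEq ?_
  filter_upwards [hSe] with q hq using hq.canonicalMap_eq hΩ hX

theorem IsExp.contDiffAt_canonicalMap_right (hΩ : IsOpen Ω) (hX : ∀ i, ContDiffOn ℝ ∞ (X i) Ω)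
    (h : IsExp Ω (comboField X B v) η ξ) : ContDiffAt ℝ ∞ (canonicalMap Ω X B η) v :=
  ContDiffAt.comp (f := fun v : B → ℝ => (η, v)) v (h.contDiffAt_canonicalMap hΩ hX)
    (contDiffAt_const.prodMk contDiffAt_id)

theorem comboField_smul (t : ℝ) (v : B → ℝ) :
    comboField X B (t • v) = fun z => t • comboField X B v z := by
  ext z
  simp [comboField, Finset.smul_sum, smul_smul]

/-- The rays through the origin are mapped to integral curves by the canonical coordinates. -/
theorem IsExp.fderiv_canonicalMap_ray (hΩ : IsOpen Ω) (hX : ∀ i, ContDiffOn ℝ ∞ (X i) Ω)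
    (h : IsExp Ω (comboField X B v) η ξ) {t : ℝ} (ht : t ∈ Icc (0 : ℝ) 1) :
    fderiv ℝ (canonicalMap Ω X B η) (t • v) v =
      comboField X B v (canonicalMap Ω X B η (t • v)) := by
  obtain ⟨φ, -, -, h3, h4⟩ := h.exists_curve
  have h5 : ∀ s ∈ Icc (0 : ℝ) 1, IsExp Ω (comboField X B (s • v)) η (φ s) := by
    intro s hs
    rw [comboField_smul]
    exact h4 s hs
  have h6 : ∀ s ∈ Icc (0 : ℝ) 1, canonicalMap Ω X B η (s • v) = φ s :=
    fun s hs => (h5 s hs).canonicalMap_eq hΩ hX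
  have h7 := (((h5 t ht).contDiffAt_canonicalMap_right hΩ hX).differentiableAt
    (by simp)).hasFDerivAt
  have h8 : HasDerivWithinAt (fun s : ℝ => s • v) v (Icc 0 1) t := by
    simpa using ((hasDerivAt_id t).smul_const v).hasDerivWithinAt
  have h9 := (h7.comp_hasDerivWithinAt t h8).congr (fun s hs => (h6 s hs).symm) (h6 t ht).symm
  rw [h6 t ht]
  exact (uniqueDiffOn_Icc zero_lt_one t ht).eq_deriv _ h9 (h3 t ht)

theorem IsExp.fderiv_canonicalMap_self (hΩ : IsOpen Ω) (hX : ∀ i, ContDiffOn ℝ ∞ (X i) Ω)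
    (h : IsExp Ω (comboField X B v) η ξ) :
    fderiv ℝ (canonicalMap Ω X B η) v v = comboField X B v (canonicalMap Ω X B η v) := by
  simpa using h.fderiv_canonicalMap_ray hΩ hX (t := 1) (by simp)

theorem fderiv_canonicalMap_zero (hΩ : IsOpen Ω) (hX : ∀ i, ContDiffOn ℝ ∞ (X i) Ω) (hη : η ∈ Ω)
    (v : B → ℝ) : fderiv ℝ (canonicalMap Ω X B η) 0 v = comboField X B v η := by
  have h1 := (isExp_zero_combo (X := X) (B := B) hη).eventually hΩ hX
  have h2 : Tendsto (fun s : ℝ => (η, s • v)) (𝓝 0) (𝓝 (η, (0 : B → ℝ))) := by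
    have : Continuous fun s : ℝ => (η, s • v) := by fun_prop
    simpa using this.tendsto 0
  -- The exponential in the direction `v` itself may not exist; a small nonzero multiple `s • v` is
  -- used and `s` cancelled by linearity.
  obtain ⟨s, hs, hs0⟩ := (((h2.eventually h1).filter_mono nhdsWithin_le_nhds).and
    (self_mem_nhdsWithin (s := {(0 : ℝ)}ᶜ))).exists
  have h3 := hs.fderiv_canonicalMap_ray hΩ hX (t := 0) (by simp)
  rw [zero_smul, canonicalMap_zero hΩ hX hη, map_smul, comboField_smul] at h3
  exact smul_right_injective _ hs0 h3

theorem isInvertible_fderiv_canonicalMap_zero (hΩ : IsOpen Ω)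
    (hX : ∀ i, ContDiffOn ℝ ∞ (X i) Ω) (hη : η ∈ Ω)
    (hb : LinearIndependent ℝ (fun I : B => comm X I.1 η) ∧
      Submodule.span ℝ (Set.range fun I : B => comm X I.1 η) = ⊤) :
    (fderiv ℝ (canonicalMap Ω X B η) 0).IsInvertible := by
  let b := Module.Basis.mk hb.1 hb.2.ge
  refine ⟨b.equivFun.symm.toContinuousLinearEquiv, ?_⟩
  ext1 v
  rw [fderiv_canonicalMap_zero hΩ hX hη]
  change b.equivFun.symm v = _
  simp [b, comboField, Module.Basis.equivFun_symm_apply]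

theorem IsExp.contDiffAt_fderiv_canonicalMap (hΩ : IsOpen Ω) (hX : ∀ i, ContDiffOn ℝ ∞ (X i) Ω)
    (h : IsExp Ω (comboField X B v) η ξ) :
    ContDiffAt ℝ ∞ (fun q : E × (B → ℝ) => fderiv ℝ (canonicalMap Ω X B q.1) q.2) (η, v) := by
  refine ContDiffAt.fderiv (f := fun q : E × (B → ℝ) => canonicalMap Ω X B q.1)
    (g := fun q => q.2) (n := ∞) ?_ contDiffAt_snd (by simp)
  exact ContDiffAt.comp (f := fun z : (E × (B → ℝ)) × (B → ℝ) => (z.1.1, z.2)) ((η, v), v)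
    (h.contDiffAt_canonicalMap hΩ hX) (by fun_prop)

theorem IsExp.eventually_isInvertible (hΩ : IsOpen Ω) (hX : ∀ i, ContDiffOn ℝ ∞ (X i) Ω)
    (h : IsExp Ω (comboField X B v) η ξ)
    (hinv : (fderiv ℝ (canonicalMap Ω X B η) v).IsInvertible) :
    ∀ᶠ q : E × (B → ℝ) in 𝓝 (η, v), (fderiv ℝ (canonicalMap Ω X B q.1) q.2).IsInvertible :=
  (h.contDiffAt_fderiv_canonicalMap hΩ hX).continuousAt
    ((ContinuousLinearEquiv.isOpen (𝕜 := ℝ) (E := B → ℝ) (F := E)).mem_nhds hinv)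

/-- The expression of a smooth field in canonical coordinates is smooth in the centre and the
coordinates. -/
theorem IsExp.contDiffAt_inCanonical (hΩ : IsOpen Ω) (hX : ∀ i, ContDiffOn ℝ ∞ (X i) Ω)
    (h : IsExp Ω (comboField X B v) η ξ)
    (hinv : (fderiv ℝ (canonicalMap Ω X B η) v).IsInvertible) {Z : E → E}
    (hZ : ContDiffOn ℝ ∞ Z Ω) :
    ContDiffAt ℝ ∞ (fun q : E × (B → ℝ) => inCanonical Ω X B q.1 Z q.2) (η, v) := by
  obtain ⟨M, hM⟩ := hinv
  have h1 : ContDiffAt ℝ ∞ ContinuousLinearMap.inverse (fderiv ℝ (canonicalMap Ω X B η) v) :=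
    hM ▸ contDiffAt_map_inverse M
  have h2 : ContDiffAt ℝ ∞ (fun q : E × (B → ℝ) =>
      (fderiv ℝ (canonicalMap Ω X B q.1) q.2).inverse) (η, v) :=
    ContDiffAt.comp (f := fun q : E × (B → ℝ) => fderiv ℝ (canonicalMap Ω X B q.1) q.2) (η, v) h1
      (h.contDiffAt_fderiv_canonicalMap hΩ hX)
  have h3 : ContDiffAt ℝ ∞ Z (canonicalMap Ω X B η v) := by
    rw [h.canonicalMap_eq hΩ hX]
    exact hZ.contDiffAt (hΩ.mem_nhds h.snd_mem)
  exact h2.clm_apply (ContDiffAt.comp (f := fun q : E × (B → ℝ) => canonicalMap Ω X B q.1 q.2)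
    (η, v) h3 (h.contDiffAt_canonicalMap hΩ hX))

/-- Near the centre the canonical coordinates are defined and nondegenerate. -/
theorem eventually_isExp_and_isInvertible (hΩ : IsOpen Ω) (hX : ∀ i, ContDiffOn ℝ ∞ (X i) Ω)
    (hη : η ∈ Ω) (hb : LinearIndependent ℝ (fun I : B => comm X I.1 η) ∧
      Submodule.span ℝ (Set.range fun I : B => comm X I.1 η) = ⊤) :
    ∀ᶠ q : E × (B → ℝ) in 𝓝 (η, 0),
      IsExp Ω (comboField X B q.2) q.1 (canonicalMap Ω X B q.1 q.2) ∧
        (fderiv ℝ (canonicalMap Ω X B q.1) q.2).IsInvertible :=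
  ((isExp_zero_combo hη).eventually hΩ hX).and ((isExp_zero_combo hη).eventually_isInvertible hΩ hX
    (isInvertible_fderiv_canonicalMap_zero hΩ hX hη hb))

theorem eventually_isExp_and_isInvertible_right (hΩ : IsOpen Ω)
    (hX : ∀ i, ContDiffOn ℝ ∞ (X i) Ω)
    (hη : η ∈ Ω) (hb : LinearIndependent ℝ (fun I : B => comm X I.1 η) ∧
      Submodule.span ℝ (Set.range fun I : B => comm X I.1 η) = ⊤) :
    ∀ᶠ v : B → ℝ in 𝓝 0,
      IsExp Ω (comboField X B v) η (canonicalMap Ω X B η v) ∧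
        (fderiv ℝ (canonicalMap Ω X B η) v).IsInvertible := by
  have hc : Continuous fun v : B → ℝ => (η, v) := by fun_prop
  exact (hc.tendsto 0).eventually (eventually_isExp_and_isInvertible hΩ hX hη hb)

theorem smoothNear_inCanonical (hΩ : IsOpen Ω) (hX : ∀ i, ContDiffOn ℝ ∞ (X i) Ω)
    (hη : η ∈ Ω) (hb : LinearIndependent ℝ (fun I : B => comm X I.1 η) ∧
      Submodule.span ℝ (Set.range fun I : B => comm X I.1 η) = ⊤) {Z : E → E}
    (hZ : ContDiffOn ℝ ∞ Z Ω) : SmoothNear (inCanonical Ω X B η Z) := by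
  filter_upwards [eventually_isExp_and_isInvertible_right hΩ hX hη hb] with v hv
  exact ContDiffAt.comp (f := fun v : B → ℝ => (η, v)) v
    (hv.1.contDiffAt_inCanonical hΩ hX hv.2 hZ) (contDiffAt_const.prodMk contDiffAt_id)

theorem inCanonical_eq_sum {κ : Type*} [Fintype κ] {Z : E → E} {c : κ → ℝ} {W : κ → E → E}
    (hη : canonicalMap Ω X B η v ∈ Ω) (h : ∀ x ∈ Ω, Z x = ∑ k, c k • W k x) :
    inCanonical Ω X B η Z v = ∑ k, c k • inCanonical Ω X B η (W k) v := by
  simp only [inCanonical, VectorField.pullback]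
  rw [h _ hη, map_sum]
  simp

/-- The structure constants of the brackets of weight `≤ r` of the commutators indexed by `B`. -/
def IsStructure (B : Finset (MultiIndex n)) (r : ℕ) (c : B → B → B → ℝ) : Prop :=
  ∀ J I : B, weight J.1 + weight I.1 ≤ r →
    (∀ L : B, weight L.1 ≠ weight J.1 + weight I.1 → c J I L = 0) ∧
    formalComm J.1 * formalComm I.1 - formalComm I.1 * formalComm J.1 =
      ∑ L : B, c J I L • formalComm L.1

theorem Generates.exists_isStructure {r : ℕ} (h : Generates B r) (hB : ∀ I ∈ B, I ≠ []) :
    ∃ c, IsStructure B r c := by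
  have h1 : ∀ J I : B, ∃ c : B → ℝ, weight J.1 + weight I.1 ≤ r →
      (∀ L : B, weight L.1 ≠ weight J.1 + weight I.1 → c L = 0) ∧
      formalComm J.1 * formalComm I.1 - formalComm I.1 * formalComm J.1 =
        ∑ L : B, c L • formalComm L.1 := by
    intro J I
    by_cases hJI : weight J.1 + weight I.1 ≤ r
    · obtain ⟨c, hc⟩ := h.exists_eq_sum hJI
        (formalComm_comm_mem_commSpan J.1 (hB _ J.2) I.1 (hB _ I.2))
      exact ⟨c, fun _ => hc⟩
    · exact ⟨0, fun h => absurd h hJI⟩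
  choose c hc using h1
  exact ⟨c, hc⟩

/-- The commutators in canonical coordinates form an Euler frame. -/
theorem eulerFrame_inCanonical {r : ℕ} {c : B → B → B → ℝ} (hc : IsStructure B r c)
    (hB : ∀ I ∈ B, I ≠ []) (hΩ : IsOpen Ω) (hX : ∀ i, ContDiffOn ℝ ∞ (X i) Ω)
    (hη : η ∈ Ω) (hb : LinearIndependent ℝ (fun I : B => comm X I.1 η) ∧
      Submodule.span ℝ (Set.range fun I : B => comm X I.1 η) = ⊤) :
    EulerFrame (fun I : B => weight I.1) r c (fun I : B => inCanonical Ω X B η (comm X I.1)) where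
  smooth J := smoothNear_inCanonical hΩ hX hη hb (contDiffOn_comm hΩ hX J.1)
  euler := by
    filter_upwards [eventually_isExp_and_isInvertible_right hΩ hX hη hb] with v ⟨h1, M, hM⟩
    have h2 := h1.fderiv_canonicalMap_self hΩ hX
    -- The coordinate map sends the radial vector `v` at `v` to `∑ v_I X_[I]`; pulling back by `M⁻¹`
    -- is the Euler identity.
    have h3 : M v = comboField X B v (canonicalMap Ω X B η v) := by rw [← h2, ← hM]; rfl
    simp only [inCanonical, VectorField.pullback, ← hM, ContinuousLinearMap.inverse_equiv]
    simp only [← map_smul, ← map_sum]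
    change M.symm (comboField X B v (canonicalMap Ω X B η v)) = v
    rw [← h3, M.symm_apply_apply]
  bracket J I hJI := by
    filter_upwards [eventually_isExp_and_isInvertible_right hΩ hX hη hb] with v ⟨h1, h2⟩
    have hn := hΩ.mem_nhds h1.snd_mem
    have h3 := VectorField.pullback_lieBracket (𝕜 := ℝ) (n := ∞)
      (by simpa using mod_cast ENat.LEInfty.out) (h1.contDiffAt_canonicalMap_right hΩ hX)
      (((contDiffOn_comm hΩ hX J.1).contDiffAt hn).differentiableAt (by simp))
      (((contDiffOn_comm hΩ hX I.1).contDiffAt hn).differentiableAt (by simp))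
    exact h3.symm.trans (inCanonical_eq_sum h1.snd_mem fun x hx =>
      lieBracket_comm_eq_sum hΩ hX (hB _ J.2) (hB _ I.2) hB (hc J I hJI).2 hx)

/-- A system satisfying the Euler identity gives an Euler frame. -/
theorem eulerFrame_comm {r : ℕ} {c : B → B → B → ℝ} (hc : IsStructure B r c)
    (hB : ∀ I ∈ B, I ≠ []) {V : Set (B → ℝ)} {Y : Fin (n + 1) → (B → ℝ) → (B → ℝ)} (hV : IsOpen V)
    (h0 : 0 ∈ V) (hY : ∀ i, ContDiffOn ℝ ∞ (Y i) V)
    (hE : ∀ u ∈ V, ∑ I : B, u I • (Pi.single I 1 : B → ℝ) = ∑ I : B, u I • comm Y I.1 u) :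
    EulerFrame (fun I : B => weight I.1) r c (fun I : B => comm Y I.1) where
  smooth J := by
    filter_upwards [hV.mem_nhds h0] with u hu
    exact (contDiffOn_comm hV hY J.1).contDiffAt (hV.mem_nhds hu)
  euler := by
    filter_upwards [hV.mem_nhds h0] with u hu
    rw [← hE u hu]
    exact (pi_eq_sum_univ' u).symm
  bracket J I hJI := by
    filter_upwards [hV.mem_nhds h0] with u hu
    exact lieBracket_comm_eq_sum hV hY (hB _ J.2) (hB _ I.2) hB (hc J I hJI).2 hu

end Canonical

/-! ### From Euler frames to weights of all commutators. -/

theorem funWeightGE_of_weightGE {n : ℕ} {B : Finset (MultiIndex n)} {f : (B → ℝ) → ℝ} {s : ℤ}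
    (sf : SmoothNear f) (h : ∀ k, WeightGE (fun I : B => weight I.1) (k + 1) f s) :
    FunWeightGE f s :=
  ⟨sf, fun k K hK => (h k).iteratedFDeriv_eq_zero sf K hK⟩

section Frames

variable {n r : ℕ} {B : Finset (MultiIndex n)} {c : B → B → B → ℝ}
  {W W' : B → (B → ℝ) → B → ℝ} {Z Z' : (B → ℝ) → B → ℝ}

/-- A field that is trivial by weight or a weight-homogeneous constant combination of an Euler
frame has the expected weight. -/
theorem EulerFrame.fieldWeightGE (hW : EulerFrame (fun I : B => weight I.1) r c W)
    (hc : IsStructure B r c) (hr : ∀ I : B, weight I.1 ≤ r) (sZ : SmoothNear Z) {w : ℕ}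
    (hZ : w ≤ r → ∃ a : B → ℝ, (∀ J : B, weight J.1 ≠ w → a J = 0) ∧
      ∀ᶠ u in 𝓝 0, Z u = ∑ J, a J • W J u) :
    FieldWeightGE Z (-(w : ℤ)) := by
  intro K
  refine funWeightGE_of_weightGE (sZ.apply K) fun k => ?_
  rcases le_or_gt w r with hw | hw
  · obtain ⟨a, ha, haZ⟩ := hZ hw
    refine WeightGE.congr (WeightGE.sum (T := Finset.univ) (f := fun J u => a J * W J u K)
      (fun J _ => ?_) fun J _ => (SmoothNear.const _).mul ((hW.smooth J).apply K)) ?_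
    · by_cases hJ : weight J.1 = w
      · exact WeightGE.const_mul ((hW.weight_frame (hW.weight_defect hr
          (fun J I L h => (hc J I h).1 L) k J K)).mono (by simp [hJ]))
          ((hW.smooth J).apply K) _
      · simpa [ha J hJ] using WeightGE.zero
    · filter_upwards [haZ] with u hu
      simp [hu]
  -- For `w > r` the required weight `|K| - w` is negative, since `|K| ≤ r`.
  · have := hr K
    exact WeightGE.of_nonpos (by omega)

/-- The same constant combinations of two Euler frames agree up to terms of higher weight. -/
theorem EulerFrame.fieldWeightGE_sub (hW : EulerFrame (fun I : B => weight I.1) r c W)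
    (hW' : EulerFrame (fun I : B => weight I.1) r c W')
    (hc : IsStructure B r c) (hr : ∀ I : B, weight I.1 ≤ r) (sZ : SmoothNear Z)
    (sZ' : SmoothNear Z') {w : ℕ}
    (hZ : w ≤ r → ∃ a : B → ℝ, (∀ J : B, weight J.1 ≠ w → a J = 0) ∧
      (∀ᶠ u in 𝓝 0, Z u = ∑ J, a J • W J u) ∧ ∀ᶠ u in 𝓝 0, Z' u = ∑ J, a J • W' J u) :
    FieldWeightGE (fun u => Z u - Z' u) (1 - (w : ℤ)) := by
  intro K
  refine funWeightGE_of_weightGE ((sZ.sub sZ').apply K) fun k => ?_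
  rcases le_or_gt w r with hw | hw
  · obtain ⟨a, ha, haZ, haZ'⟩ := hZ hw
    have sD : ∀ J, SmoothNear fun u =>
        EulerFrame.defect W J K u - EulerFrame.defect W' J K u :=
      fun J => (hW.smooth_defect J K).sub (hW'.smooth_defect J K)
    refine WeightGE.congr (WeightGE.sum (T := Finset.univ) (f := fun J u =>
      a J * (EulerFrame.defect W J K u - EulerFrame.defect W' J K u))
      (fun J _ => ?_) fun J _ => (SmoothNear.const _).mul (sD J)) ?_
    · by_cases hJ : weight J.1 = w
      · exact WeightGE.const_mul ((hW.weight_sub hW' hr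
          (fun J I L h => (hc J I h).1 L) k J K).mono (by simp [hJ]; omega)) (sD J) _
      · simpa [ha J hJ] using WeightGE.zero
    · filter_upwards [haZ, haZ'] with u hu hu'
      simp [hu, hu', EulerFrame.defect, mul_sub, Finset.sum_sub_distrib]
  -- Even with the extra unit, `1 + |K| - w ≤ 0` because `|K| ≤ r < w`.
  · have := hr K
    exact WeightGE.of_nonpos (by omega)

end Frames

/-- By the chain rule `Df ∘ Dg = 1`, so either factor being invertible makes them mutually inverse.
Invertibility of `Df` is the known fact when `Θ` is constructed, that of `Dg` when `Θ` is given. -/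
theorem inverse_eq_of_comp_eventuallyEq_id {E F : Type*} [NormedAddCommGroup E] [NormedSpace ℝ E]
    [NormedAddCommGroup F] [NormedSpace ℝ F] {f : F → E} {g : E → F} {x : E}
    (hf : DifferentiableAt ℝ f (g x)) (hg : DifferentiableAt ℝ g x) (h : ∀ᶠ y in 𝓝 x, f (g y) = y)
    (hinv : (fderiv ℝ f (g x)).IsInvertible ∨ (fderiv ℝ g x).IsInvertible) :
    (fderiv ℝ f (g x)).IsInvertible ∧ (fderiv ℝ g x).IsInvertible ∧
      (fderiv ℝ f (g x)).inverse = fderiv ℝ g x := by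
  have h1 : (fderiv ℝ f (g x)).comp (fderiv ℝ g x) = ContinuousLinearMap.id ℝ E :=
    ((hf.hasFDerivAt.comp x hg.hasFDerivAt).congr_of_eventuallyEq
      (h.mono fun y hy => hy.symm)).unique (hasFDerivAt_id x)
  have h2 : ∀ v, fderiv ℝ f (g x) (fderiv ℝ g x v) = v := fun v =>
    congrArg (fun T : E →L[ℝ] E => T v) h1
  rcases hinv with ⟨M, hM⟩ | ⟨M, hM⟩
  · have h3 : (M.symm : E →L[ℝ] F) = fderiv ℝ g x := by
      ext1 v
      have := h2 v
      rw [← hM] at this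
      change M.symm v = _
      rw [ContinuousLinearEquiv.symm_apply_eq]
      exact this.symm
    exact ⟨⟨M, hM⟩, ⟨M.symm, h3⟩, by rw [← hM, ContinuousLinearMap.inverse_equiv, h3]⟩
  · have h3 : (M.symm : F →L[ℝ] E) = fderiv ℝ f (g x) := by
      ext1 v
      have := h2 (M.symm v)
      rw [← hM] at this
      change M.symm v = _
      rw [← this]
      congr 1
      exact M.apply_symm_apply v
    exact ⟨⟨M.symm, h3⟩, ⟨M, hM⟩, by rw [← h3, ContinuousLinearMap.inverse_equiv, ← hM]; rfl⟩

/-! ### The maps `Θ`. -/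

section Theta

set_option linter.unusedSectionVars false

variable {E : Type u} [NormedAddCommGroup E] [NormedSpace ℝ E] [FiniteDimensional ℝ E]
  {Ω : Set E} {n : ℕ} {X : Fin (n + 1) → E → E} {B : Finset (MultiIndex n)} {η ξ : E}
  {W : Set (E × E)} {Θ : E → E → B → ℝ}

theorem exists_isThetaMap (hΩ : IsOpen Ω) (hX : ∀ i, ContDiffOn ℝ ∞ (X i) Ω)
    (hη : η ∈ Ω) (hb : LinearIndependent ℝ (fun I : B => comm X I.1 η) ∧
      Submodule.span ℝ (Set.range fun I : B => comm X I.1 η) = ⊤) :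
    ∃ (W : Set (E × E)) (Θ : E → E → B → ℝ), IsThetaMap Ω X B W Θ ∧ (η, η) ∈ W := by
  let Φ : E × (B → ℝ) → E := fun q => canonicalMap Ω X B q.1 q.2
  let Ψ : E × (B → ℝ) → E × E := fun q => (q.1, Φ q)
  obtain ⟨G, hGgood, hGo, hGη⟩ :=
    mem_nhds_iff.1 (eventually_isExp_and_isInvertible hΩ hX hη hb)
  have hΨs : ∀ q ∈ G, ContDiffAt ℝ ∞ Ψ q := fun q hq =>
    contDiffAt_fst.prodMk ((hGgood hq).1.contDiffAt_canonicalMap hΩ hX)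
  have hΨd : ∀ q ∈ G, ∃ L : (E × (B → ℝ)) ≃L[ℝ] E × E,
      HasFDerivAt Ψ (L : E × (B → ℝ) →L[ℝ] E × E) q := by
    intro q hq
    obtain ⟨h1, M, hM⟩ := hGgood hq
    refine exists_equiv_hasFDerivAt_graph
      ((h1.contDiffAt_canonicalMap hΩ hX).differentiableAt (by simp)) M ?_
    rw [hM]
    exact ((h1.contDiffAt_canonicalMap_right hΩ hX).differentiableAt (by simp)).hasFDerivAt
  have hΨ0 : ∀ x ∈ Ω, Ψ (x, 0) = (x, x) := fun x hx =>
    Prod.ext rfl (canonicalMap_zero hΩ hX hx)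
  obtain ⟨L, hL⟩ := hΨd _ hGη
  let e : OpenPartialHomeomorph (E × (B → ℝ)) (E × E) :=
    (hΨs _ hGη).toOpenPartialHomeomorph Ψ hL (by simp)
  have he : ∀ q, e q = Ψ q := fun _ => rfl
  have hes : (η, 0) ∈ e.source := (hΨs _ hGη).mem_toOpenPartialHomeomorph_source hL (by simp)
  -- Besides the domain of the local inverse of `(η, u) ↦ (η, exp(∑ u_I X_[I])(η))`, membership of
  -- `(η, 0)` in the source is required: it forces the inverse at `(η, η)` to be `(η, 0)`, that is,
  -- `Θ(η, η) = 0`.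
  let W : Set (E × E) := (e.target ∩ e.symm ⁻¹' G) ∩ (fun y : E × E => (y.1, (0 : B → ℝ))) ⁻¹' e.source
  have hWo : IsOpen W := by
    refine (e.symm.isOpen_inter_preimage hGo).inter (e.open_source.preimage ?_)
    fun_prop
  have hW : ∀ y ∈ W, Ψ (e.symm y) = y := fun y hy => e.right_inv hy.1.1
  have hW1 : ∀ y ∈ W, (e.symm y).1 = y.1 := fun y hy => congrArg Prod.fst (hW y hy)
  have hWe : ∀ y ∈ W, e.symm y = (y.1, (e.symm y).2) := fun y hy => Prod.ext (hW1 y hy) rfl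
  have hW2 : ∀ y ∈ W, canonicalMap Ω X B y.1 (e.symm y).2 = y.2 := by
    intro y hy
    rw [← hW1 y hy]
    exact congrArg Prod.snd (hW y hy)
  have hWexp : ∀ y ∈ W, IsExp Ω (comboField X B (e.symm y).2) y.1 y.2 := by
    intro y hy
    have h1 := (hGgood hy.1.2).1
    rw [hW1 y hy, hW2 y hy] at h1
    exact h1
  have hsmooth : ∀ y ∈ W, ContDiffAt ℝ ∞ e.symm y := by
    intro y hy
    obtain ⟨L', hL'⟩ := hΨd _ hy.1.2
    exact e.contDiffAt_symm hy.1.1 hL' (hΨs _ hy.1.2)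
  have hΘs : ∀ y ∈ W, ContDiffAt ℝ ∞ (fun y => (e.symm y).2) y := fun y hy =>
    contDiffAt_snd.comp y (hsmooth y hy)
  refine ⟨W, fun x y => (e.symm (x, y)).2, ⟨hWo, fun y hy => ⟨(hWexp y hy).fst_mem,
    (hWexp y hy).snd_mem⟩, fun y hy => (hΘs y hy).contDiffWithinAt, fun x hx => ?_,
    fun x y hxy => hWexp _ hxy, fun x y hxy => ?_⟩, ?_⟩
  · have h1 := e.left_inv hx.2
    rw [he, hΨ0 x (hWexp _ hx).fst_mem] at h1
    exact congrArg Prod.snd h1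
  · obtain ⟨h1, h2⟩ := hGgood hxy.1.2
    rw [hW1 _ hxy] at h1 h2
    have hc : Continuous fun z : E => (x, z) := by fun_prop
    refine (inverse_eq_of_comp_eventuallyEq_id (f := canonicalMap Ω X B x)
      ((h1.contDiffAt_canonicalMap_right hΩ hX).differentiableAt (by simp)) ?_ ?_ (.inl h2)).2.1
    · exact (ContDiffAt.comp (f := fun z : E => (x, z)) y (hΘs _ hxy)
        (contDiffAt_const.prodMk contDiffAt_id)).differentiableAt (by simp)
    · filter_upwards [hc.continuousAt.eventually (hWo.mem_nhds hxy)] with z hz using hW2 _ hz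
  · have h1 : e.symm (η, η) = (η, 0) := by
      rw [← hΨ0 η hη, ← he]
      exact e.left_inv hes
    refine ⟨⟨?_, ?_⟩, hes⟩
    · rw [← hΨ0 η hη, ← he]
      exact e.map_source hes
    · rw [mem_preimage, h1]
      exact hGη

namespace IsThetaMap

theorem contDiffAt_right (hΘ : IsThetaMap Ω X B W Θ) (h : (η, ξ) ∈ W) :
    ContDiffAt ℝ ∞ (Θ η) ξ :=
  ContDiffAt.comp (f := fun z : E => (η, z)) ξ (hΘ.smooth.contDiffAt (hΘ.isOpen.mem_nhds h))
    (contDiffAt_const.prodMk contDiffAt_id)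

/-- The derivative of `Θ(η, ·)` is inverse to that of the canonical coordinates. -/
theorem inverse_fderiv_canonicalMap (hΘ : IsThetaMap Ω X B W Θ) (hΩ : IsOpen Ω)
    (hX : ∀ i, ContDiffOn ℝ ∞ (X i) Ω) (h : (η, ξ) ∈ W) :
    (fderiv ℝ (canonicalMap Ω X B η) (Θ η ξ)).IsInvertible ∧
      (fderiv ℝ (canonicalMap Ω X B η) (Θ η ξ)).inverse = fderiv ℝ (Θ η) ξ := by
  have hc : Continuous fun z : E => (η, z) := by fun_prop
  have h1 := inverse_eq_of_comp_eventuallyEq_id (f := canonicalMap Ω X B η)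
    (((hΘ.exp_eq η ξ h).contDiffAt_canonicalMap_right hΩ hX).differentiableAt (by simp))
    ((hΘ.contDiffAt_right h).differentiableAt (by simp)) (by
      filter_upwards [hc.continuousAt.eventually (hΘ.isOpen.mem_nhds h)] with z hz
      exact (hΘ.exp_eq η z hz).canonicalMap_eq hΩ hX) (.inr (hΘ.localDiffeo η ξ h))
  exact ⟨h1.1, h1.2.2⟩

theorem inCanonical_apply (hΘ : IsThetaMap Ω X B W Θ) (hΩ : IsOpen Ω)
    (hX : ∀ i, ContDiffOn ℝ ∞ (X i) Ω) (h : (η, ξ) ∈ W) (Z : E → E) :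
    inCanonical Ω X B η Z (Θ η ξ) = fderiv ℝ (Θ η) ξ (Z ξ) := by
  rw [inCanonical, VectorField.pullback, (hΘ.inverse_fderiv_canonicalMap hΩ hX h).2,
    (hΘ.exp_eq η ξ h).canonicalMap_eq hΩ hX]

theorem act_comp (hΘ : IsThetaMap Ω X B W Θ) (hΩ : IsOpen Ω)
    (hX : ∀ i, ContDiffOn ℝ ∞ (X i) Ω) (h : (η, ξ) ∈ W) (Z : E → E) {f : (B → ℝ) → ℝ}
    (hf : DifferentiableAt ℝ f (Θ η ξ)) :
    act Z (fun ζ => f (Θ η ζ)) ξ = fderiv ℝ f (Θ η ξ) (inCanonical Ω X B η Z (Θ η ξ)) := by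
  rw [hΘ.inCanonical_apply hΩ hX h, act]
  have := hf.hasFDerivAt.comp ξ ((hΘ.contDiffAt_right h).differentiableAt (by simp)).hasFDerivAt
  exact congrArg (fun T : E →L[ℝ] ℝ => T (Z ξ)) this.fderiv

end IsThetaMap

end Theta

end

end HormanderApprox

/-! ### The approximation theorem. -/

open HormanderApprox

theorem mainTheorem8 {p n r : ℕ} (Ω : Set (Fin p → ℝ)) (hΩ : IsOpen Ω)
    (X : Fin (n + 1) → (Fin p → ℝ) → (Fin p → ℝ))
    (hX : ∀ i, ContDiffOn ℝ ∞ (X i) Ω)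
    (hfree : ∀ x ∈ Ω, HormanderApprox.FreeUpTo X r x)
    (B : Finset (HormanderApprox.MultiIndex n))
    (hB : ∀ I ∈ B, I ≠ [] ∧ HormanderApprox.weight I ≤ r)
    (hbasis : ∀ x ∈ Ω, LinearIndependent ℝ (fun I : B => HormanderApprox.comm X I.1 x) ∧
      Submodule.span ℝ (Set.range fun I : B => HormanderApprox.comm X I.1 x) = ⊤) :
    -- the map `Θ` exists near every point of the diagonal
    (∀ ξ₀ ∈ Ω, ∃ (W : Set ((Fin p → ℝ) × (Fin p → ℝ)))
      (Θ : (Fin p → ℝ) → (Fin p → ℝ) → (B → ℝ)),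
      HormanderApprox.IsThetaMap Ω X B W Θ ∧ (ξ₀, ξ₀) ∈ W) ∧
    -- `X_[I]` has weight `≥ -|I|` at every point of `Ω`
    (∀ η ∈ Ω, ∀ I : HormanderApprox.MultiIndex n, I ≠ [] →
      HormanderApprox.FieldWeightGE
        (HormanderApprox.inCanonical Ω X B η (HormanderApprox.comm X I))
        (-(HormanderApprox.weight I : ℤ))) ∧
    -- approximation by any smooth system `Y` satisfying the Euler identity near `u = 0`
    ∀ (V : Set (B → ℝ)) (Y : Fin (n + 1) → (B → ℝ) → (B → ℝ)),
      IsOpen V → 0 ∈ V → (∀ i, ContDiffOn ℝ ∞ (Y i) V) →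
      (∀ u ∈ V, ∑ I : B, u I • (Pi.single I 1 : B → ℝ) =
        ∑ I : B, u I • HormanderApprox.comm Y I.1 u) →
      -- `X_[I] - Y_[I]` has weight `≥ 1 - |I|` at every point of `Ω`
      (∀ η ∈ Ω, ∀ I : HormanderApprox.MultiIndex n, I ≠ [] →
        HormanderApprox.FieldWeightGE
          (fun u => HormanderApprox.inCanonical Ω X B η (HormanderApprox.comm X I) u
            - HormanderApprox.comm Y I u)
          (1 - (HormanderApprox.weight I : ℤ))) ∧
      -- the remainders `R_{η,[I]}`
      ∃ R : HormanderApprox.MultiIndex n → (Fin p → ℝ) → (B → ℝ) → (B → ℝ),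
        (∀ η ∈ Ω, ∀ I : HormanderApprox.MultiIndex n, I ≠ [] →
          HormanderApprox.FieldWeightGE (R I η) (1 - (HormanderApprox.weight I : ℤ))) ∧
        ∀ (W : Set ((Fin p → ℝ) × (Fin p → ℝ)))
          (Θ : (Fin p → ℝ) → (Fin p → ℝ) → (B → ℝ)),
          HormanderApprox.IsThetaMap Ω X B W Θ →
          ∀ I : HormanderApprox.MultiIndex n, I ≠ [] →
            -- `R_{η,[I]}(u)` depends smoothly on `(η, u)`
            ContDiffOn ℝ ∞ (fun q : (Fin p → ℝ) × (B → ℝ) => R I q.1 q.2)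
              {q | ∃ ξ, (q.1, ξ) ∈ W ∧ q.2 = Θ q.1 ξ ∧ q.2 ∈ V} ∧
            -- the approximation formula
            ∀ η ξ, (η, ξ) ∈ W → Θ η ξ ∈ V →
              ∀ f : (B → ℝ) → ℝ, ContDiffAt ℝ ∞ f (Θ η ξ) →
                HormanderApprox.act (HormanderApprox.comm X I) (fun ζ => f (Θ η ζ)) ξ =
                  HormanderApprox.act (HormanderApprox.comm Y I) f (Θ η ξ) +
                  HormanderApprox.act (R I η) f (Θ η ξ) := by
  have hne : ∀ I ∈ B, I ≠ [] := fun I hI => (hB I hI).1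
  have hr : ∀ I : B, weight I.1 ≤ r := fun I => (hB I.1 I.2).2
  -- The conclusion does not depend on `η`, but a point is needed to use freeness, and `Ω` may be
  -- empty.
  have hgen : ∀ η ∈ Ω, Generates B r := fun η hη L hL hLr =>
    exists_formalComm_eq_sum (hfree η hη) hB (hbasis η hη).2 hL hLr
  have hcomb : ∀ η ∈ Ω, ∀ I : MultiIndex n, I ≠ [] → weight I ≤ r →
      ∃ a : B → ℝ, (∀ J : B, weight J.1 ≠ weight I → a J = 0) ∧
        formalComm I = ∑ K : B, a K • formalComm K.1 := fun η hη I hI hIr => hgen η hη I hI hIr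
  have hcan : ∀ η ∈ Ω, ∀ (I : MultiIndex n) (a : B → ℝ), I ≠ [] →
      formalComm I = ∑ K : B, a K • formalComm K.1 →
      ∀ᶠ u in 𝓝 (0 : B → ℝ), inCanonical Ω X B η (comm X I) u =
        ∑ K : B, a K • inCanonical Ω X B η (comm X K.1) u := by
    intro η hη I a hI ha
    filter_upwards [eventually_isExp_and_isInvertible_right hΩ hX hη (hbasis η hη)] with u hu
    exact inCanonical_eq_sum hu.1.snd_mem fun x hx => comm_eq_sum hΩ hX hI hne ha hx
  refine ⟨fun ξ₀ hξ₀ => exists_isThetaMap hΩ hX hξ₀ (hbasis ξ₀ hξ₀), ?_, ?_⟩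
  · intro η hη I hI
    obtain ⟨c, hc⟩ := (hgen η hη).exists_isStructure hne
    refine (eulerFrame_inCanonical hc hne hΩ hX hη (hbasis η hη)).fieldWeightGE hc hr
      (smoothNear_inCanonical hΩ hX hη (hbasis η hη) (contDiffOn_comm hΩ hX I)) fun hIr => ?_
    obtain ⟨a, ha, haI⟩ := hcomb η hη I hI hIr
    exact ⟨a, ha, hcan η hη I a hI haI⟩
  · intro V Y hV h0 hY hE
    have hweight : ∀ η ∈ Ω, ∀ I : MultiIndex n, I ≠ [] →
        FieldWeightGE (fun u => inCanonical Ω X B η (comm X I) u - comm Y I u)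
          (1 - (weight I : ℤ)) := by
      intro η hη I hI
      obtain ⟨c, hc⟩ := (hgen η hη).exists_isStructure hne
      refine (eulerFrame_inCanonical hc hne hΩ hX hη (hbasis η hη)).fieldWeightGE_sub
        (eulerFrame_comm hc hne hV h0 hY hE) hc hr
        (smoothNear_inCanonical hΩ hX hη (hbasis η hη) (contDiffOn_comm hΩ hX I)) ?_ fun hIr => ?_
      · filter_upwards [hV.mem_nhds h0] with u hu
        exact (contDiffOn_comm hV hY I).contDiffAt (hV.mem_nhds hu)
      · obtain ⟨a, ha, haI⟩ := hcomb η hη I hI hIr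
        refine ⟨a, ha, hcan η hη I a hI haI, ?_⟩
        filter_upwards [hV.mem_nhds h0] with u hu
        exact comm_eq_sum hV hY hI hne haI hu
    -- The remainder is the difference itself. It involves only `canonicalMap`, so one choice serves
    -- every `Θ`.
    refine ⟨hweight, fun I η u => inCanonical Ω X B η (comm X I) u - comm Y I u, hweight, ?_⟩
    intro W Θ hΘ I _
    refine ⟨?_, fun η ξ hW _ f hf => ?_⟩
    · rintro ⟨η, u⟩ ⟨ξ, hW, hu, huV⟩
      dsimp only at hW hu huV
      subst hu
      -- The point `Θ η ξ` need not be near `0`: smoothness there follows from existence of the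
      -- exponential and from invertibility of the coordinate map's derivative, which the local
      -- diffeomorphism property of `Θ` provides.
      have h1 := (hΘ.exp_eq η ξ hW).contDiffAt_inCanonical hΩ hX
        (hΘ.inverse_fderiv_canonicalMap hΩ hX hW).1 (contDiffOn_comm hΩ hX I)
      have h2 : ContDiffAt ℝ ∞ (comm Y I) (Θ η ξ) :=
        (contDiffOn_comm hV hY I).contDiffAt (hV.mem_nhds huV)
      exact (h1.sub (ContDiffAt.comp (f := fun q : (Fin p → ℝ) × (B → ℝ) => q.2) (η, Θ η ξ) h2
        contDiffAt_snd)).contDiffWithinAt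
    · rw [hΘ.act_comp hΩ hX hW _ (hf.differentiableAt (by simp)), act, act, ← map_add,
        add_sub_cancel]
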